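/- Let $k$ be a field of characteristic zero, $F|k$ an algebraically closed extension of countably infinite transcendence degree, and $G=G_{F|k}=\mathrm{Aut}(F|k)$; for a subfield $L\subseteq F$ containing $k$ let $G_{F|L}\subseteq G$ be the subgroup of automorphisms trivial on $L$. Let $W\in\mathcal{S}m_G$, i.e. $W$ is a $\mathbb{Q}$-linear representation of $G$ in which every vector is fixed by $G_{F|L}$ for some $L$ finitely generated over $k$. A discrete valuation of $F$ of rank one, trivial on $k$, is a surjective valuation $v:F^\times/k^\times\to\mathbb{Q}$ such that $F$ is algebraic over the subfield generated by a lifting $F'\subset\mathcal{O}_v$ of the residue field, $k\subseteq F'$, and by an isomorphic lifting of the value group $\mathbb{Q}$. Let $G_v\subseteq G$ be the stabilizer of $\mathcal{O}_v$ and $W_v:=\sum_{\sigma\in G_v}W^{G_{F|\sigma(F')}}\subseteq W$ for such $F'$ (this does not depend on the choice of $F'$, as all such $F'$ are conjugate under $G_v$). The Hartogs site $\mathfrak{H}$ is defined as follows. Its objects are the smooth varieties over $k$ (separated smooth $k$-schemes of finite type). Its morphisms are the locally dominant $k$-morphisms (generic points are sent to generic points) that transform every prime divisor which is not dominant over a component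 of the target to a prime divisor (i.e. the closure of its image is one). Its coverings are the smooth morphisms $U\to X$ whose image contains the generic points of $X$ and the generic points of all prime divisors on $X$. Fix, for every smooth $k$-variety $X$ and every $x$ in the set $X^0$ of its generic points, a $k$-embedding of the function field $k(x)$ into $F$. Let $\mathfrak{V}(X,x)$ be the set of discrete valuations of $F$ of rank one, trivial on $k$, whose restriction to $k(x)\subset F$ is either trivial or the valuation (up to equivalence) of a prime divisor on the component $\overline{\{x\}}$ of $X$. Set $$\mathcal{W}(X):=\prod_{x\in X^0}\Bigl(W^{G_{F|k(x)}}\cap\bigcap_{v\in\mathfrak{V}(X,x)}W_v\Bigr).$$ Then for any morphism $f:U\to X$ of $\mathfrak{H}$ and any $u\in U^0$ there is $\tau_u\in G$ extending the embedding $f^*:k(f(u))\hookrightarrow k(u)$ of subfields of $F$; the formula $(w_x)_{x\in X^0}\mapsto(\tau_u w_{f(u)})_{u\in U^0}$ does not depend on the choice of the $\tau_u$, maps $\mathcal{W}(X)$ into $\mathcal{W}(U)$, and makes $\mathcal{W}$ a presheaf of $\mathbb{Q}$-vector spaces on $\mathfrak{H}$. This presheaf is a sheaf: it is a sheaf for the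 Grothendieck topology on $\mathfrak{H}$ generated by the coverings, and for every covering $U\to X$ the sequence $\mathcal{W}(X)\to\mathcal{W}(U)\rightrightarrows\mathcal{W}(U\times_XU)$, where $U\times_XU$ is the fibre product of schemes, is exact (an equalizer). -/

import Mathlib

open CategoryTheory CategoryTheory.Limits AlgebraicGeometry Opposite Order

universe u v w

noncomputable section

/-! ### The Hartogs site of a field `k` -/

/-- A smooth `k`-variety: a separated smooth `k`-scheme of finite type (possibly disconnected,
possibly empty). -/
structure SmoothVariety (k : Type u) [Field k] : Type (u + 1) where
  /-- the underlying scheme -/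
  scheme : Scheme.{u}
  /-- the structure morphism -/
  str : scheme ⟶ Spec (CommRingCat.of k)
  [smooth : Smooth str]
  [separated : IsSeparated str]
  [quasiCompact : QuasiCompact str]

namespace SmoothVariety

variable {k : Type u} [Field k]

attribute [instance] SmoothVariety.smooth SmoothVariety.separated SmoothVariety.quasiCompact

/-- Morphisms of the Hartogs site: locally dominant `k`-morphisms (generic points are sent to
generic points) such that every prime divisor, given by its generic point, a point of
codimension `1`, is either dominant over a component of the target or is sent to a prime divisor.
The codimension of a point of a scheme is its coheight in the specialization order. -/
@[ext]
structure Hom (U X : SmoothVariety k) : Type u where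
  /-- the underlying morphism of schemes -/
  hom : U.scheme ⟶ X.scheme
  w : hom ≫ X.str = U.str
  dominant : ∀ x : U.scheme, coheight x = 0 → coheight (hom x) = 0
  divisor : ∀ x : U.scheme, coheight x = 1 → coheight (hom x) = 0 ∨ coheight (hom x) = 1

instance : Category (SmoothVariety k) where
  Hom := Hom
  id X :=
    { hom := 𝟙 X.scheme
      w := by simp
      dominant := fun x hx => by simpa using hx
      divisor := fun x hx => Or.inr (by simpa using hx) }
  comp f g :=
    { hom := f.hom ≫ g.hom
      w := by rw [Category.assoc, g.w, f.w]
      dominant := fun x hx => by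
        simpa using g.dominant _ (f.dominant x hx)
      divisor := fun x hx => by
        rcases f.divisor x hx with h | h
        · exact Or.inl (by simpa using g.dominant _ h)
        · simpa using g.divisor _ h }
  id_comp f := Hom.ext (Category.id_comp f.hom)
  comp_id f := Hom.ext (Category.comp_id f.hom)
  assoc f g h := Hom.ext (Category.assoc f.hom g.hom h.hom)

/-- Coverings of the Hartogs site: smooth morphisms whose image contains every generic point and
the generic point of every prime divisor of the target. -/
structure IsCovering {U X : SmoothVariety k} (f : U ⟶ X) : Prop where
  smooth : Smooth f.hom
  surj : ∀ x : X.scheme, coheight x ≤ 1 → ∃ u : U.scheme, f.hom u = x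

variable (k) in
/-- The covering families of the Hartogs site: those that consist of one covering morphism. -/
def hartogsPrecoverage : Precoverage (SmoothVariety k) where
  coverings X := {R | ∃ (U : SmoothVariety k) (f : U ⟶ X), IsCovering f ∧ R = Presieve.singleton f}

variable (k) in
/-- The Hartogs topology. -/
def hartogsTopology : GrothendieckTopology (SmoothVariety k) :=
  (hartogsPrecoverage k).toGrothendieck

/-! Smooth morphisms belong to the Hartogs site. -/

theorem coheight_le_of_generalizingMap {X Y : Scheme.{u}} (f : X ⟶ Y)
    (hf : GeneralizingMap f) (x : X) : coheight (f x) ≤ coheight x := by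
  have key : ∀ (n : ℕ) (x : X), (n : ℕ∞) ≤ coheight (f x) → (n : ℕ∞) ≤ coheight x := by
    intro n
    induction n with
    | zero => intro x _; simp
    | succ n ih =>
      intro x hx
      obtain ⟨p, hp, hl⟩ := exists_series_of_le_coheight (f x) hx
      have h0 : f x < p 1 := by
        rw [← hp]
        have : (0 : Fin (p.length + 1)) < 1 := by
          rw [Fin.lt_def]
          have h1 : 1 < p.length + 1 := by omega
          simp [Nat.mod_eq_of_lt h1]
        exact p.strictMono this
      have h1 : (n : ℕ∞) ≤ coheight (p 1) := by
        have := rev_index_le_coheight p 1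
        refine le_trans ?_ this
        have h2 : 1 < p.length + 1 := by omega
        have h3 : ((1 : Fin (p.length + 1)) : ℕ) = 1 := by
          simp [Nat.mod_eq_of_lt h2]
        rw [Fin.val_rev, h3]
        exact_mod_cast (by omega : n ≤ p.length + 1 - (1 + 1))
      obtain ⟨y, hy, hfy⟩ := hf (show p 1 ⤳ f x from h0.le)
      rw [← hfy] at h1 h0
      have hlt : x < y := by
        refine lt_of_le_not_ge hy fun h => ?_
        exact h0.not_ge (show f x ⤳ f y from Specializes.map h f.continuous)
      have := coheight_add_one_le hlt
      refine le_trans ?_ this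
      push_cast
      gcongr
      exact ih y h1
  refine ENat.forall_natCast_le_iff_le.mp fun n hn => key n x hn

/-- A smooth `k`-morphism is a morphism of the Hartogs site. -/
def ofSmooth {U X : SmoothVariety k} (g : U.scheme ⟶ X.scheme) (hg : g ≫ X.str = U.str)
    [hs : Smooth g] : U ⟶ X :=
  have key := coheight_le_of_generalizingMap g (Flat.generalizingMap g)
  Hom.mk g hg
    (fun x hx => le_antisymm (hx ▸ key x) zero_le)
    (fun x hx => Order.le_one_iff.mp (hx ▸ key x))

/-- The fibre square `U ×_X U` (as a scheme) of a smooth morphism `f : U ⟶ X`. -/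
def fibreSquare {U X : SmoothVariety k} (f : U ⟶ X) (hf : Smooth f.hom) : SmoothVariety k :=
  have : IsSeparated f.hom := by
    have : IsSeparated (f.hom ≫ X.str) := f.w ▸ U.separated
    exact IsSeparated.of_comp f.hom X.str
  have : QuasiCompact f.hom := by
    have : QuasiCompact (f.hom ≫ X.str) := f.w ▸ U.quasiCompact
    exact QuasiCompact.of_comp f.hom X.str
  { scheme := pullback f.hom f.hom
    str := pullback.fst f.hom f.hom ≫ U.str }

theorem fibreSquare_smooth_fst {U X : SmoothVariety k} (f : U ⟶ X) (hf : Smooth f.hom) :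
    Smooth (pullback.fst f.hom f.hom) := by
  infer_instance

theorem fibreSquare_smooth_snd {U X : SmoothVariety k} (f : U ⟶ X) (hf : Smooth f.hom) :
    Smooth (pullback.snd f.hom f.hom) := by
  infer_instance

/-- The first projection `U ×_X U ⟶ U`. -/
def fibreSquareFst {U X : SmoothVariety k} (f : U ⟶ X) (hf : Smooth f.hom) :
    fibreSquare f hf ⟶ U :=
  ofSmooth (U := fibreSquare f hf) (pullback.fst f.hom f.hom) (hs := fibreSquare_smooth_fst f hf) rfl

theorem fibreSquare_w {U X : SmoothVariety k} (f : U ⟶ X) :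
    pullback.snd f.hom f.hom ≫ U.str = pullback.fst f.hom f.hom ≫ U.str := by
  rw [← f.w, ← Category.assoc, ← Category.assoc, pullback.condition]

/-- The second projection `U ×_X U ⟶ U`. -/
def fibreSquareSnd {U X : SmoothVariety k} (f : U ⟶ X) (hf : Smooth f.hom) :
    fibreSquare f hf ⟶ U :=
  ofSmooth (U := fibreSquare f hf) (pullback.snd f.hom f.hom) (hs := fibreSquare_smooth_snd f hf) (fibreSquare_w f)

/-- The set `X⁰` of generic points of (the irreducible components of) `X`. -/
abbrev GenericPoint (X : SmoothVariety k) : Type u := {x : X.scheme // coheight x = 0}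

/-- The map on generic points induced by a morphism of the Hartogs site. -/
def Hom.onGeneric {U X : SmoothVariety k} (f : U ⟶ X) (x : GenericPoint U) : GenericPoint X :=
  ⟨f.hom x.1, f.dominant x.1 x.2⟩

/-- Residue fields of `k`-varieties are extensions of `k`. At a generic point, the residue field
is the function field of the component. -/
instance (X : SmoothVariety k) (x : X.scheme) : Algebra k (X.scheme.residueField x) :=
  (Spec.preimage (X.scheme.fromSpecResidueField x ≫ X.str)).hom.toAlgebra

end SmoothVariety

/-! ### Smooth representations of the automorphism group and valuations -/

section Representations

variable {k : Type u} [Field k] {F : Type v} [Field F] [Algebra k F]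
  {W : Type w} [AddCommGroup W] [Module ℚ W]

/-- `ρ` is smooth: every vector is fixed by the pointwise stabilizer of a finite subset of `F`. -/
def IsSmoothRep (ρ : Representation ℚ (F ≃ₐ[k] F) W) : Prop :=
  ∀ x : W, ∃ S : Finset F, ∀ σ ∈ fixingSubgroup (F ≃ₐ[k] F) (S : Set F), ρ σ x = x

/-- The vectors fixed by the group of all `k`-automorphisms of `F` that are trivial on `S`. -/
def fixedVectors (ρ : Representation ℚ (F ≃ₐ[k] F) W) (S : Set F) : Submodule ℚ W :=
  Representation.invariants (ρ.comp (fixingSubgroup (F ≃ₐ[k] F) S).subtype)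

/-- Valuations of `F` with values in `ℚ` (and `0`), written multiplicatively. -/
abbrev RatValuation (F : Type v) [Field F] : Type v :=
  Valuation F (WithZero (Multiplicative ℚ))

/-- The subfield `L` of `F` over `k` is a lifting of the residue field of `v`, and `F` is
algebraic over the subfield that `L` generates together with some lifting `s` of the value
group. -/
structure IsResidueLift (v : RatValuation F) (L : IntermediateField k F) : Prop where
  integral : ∀ a ∈ L, v a ≤ 1
  surj : ∀ a : F, v a ≤ 1 → ∃ b ∈ L, v (a - b) < 1
  algebraic : ∃ s : Multiplicative ℚ →* Fˣ, (∀ q, v (s q : F) = (q : WithZero (Multiplicative ℚ))) ∧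
    Algebra.IsAlgebraic
      (IntermediateField.adjoin k ((L : Set F) ∪ Set.range fun q => (s q : F))) F

variable (k) in
/-- `v` is a discrete valuation of rank one of `F`, trivial on `k`, i.e. it is given by a surjection
`Fˣ/kˣ → ℚ` and `F` is algebraic over the subfield generated by an isomorphic lifting of the
residue field and an isomorphic lifting of the value group. -/
structure IsDiscreteRankOne (v : RatValuation F) : Prop where
  trivial : ∀ a : k, a ≠ 0 → v (algebraMap k F a) = 1
  surj : Function.Surjective v
  lift : ∃ L : IntermediateField k F, IsResidueLift v L

/-- The subspace `W_v`: the sum of the subspaces of vectors fixed by all automorphisms over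
`σ(L)`, where `σ` runs over the decomposition group of `v` and `L` is a lifting of the residue
field. -/
def localPart (ρ : Representation ℚ (F ≃ₐ[k] F) W) (v : RatValuation F) : Submodule ℚ W :=
  ⨆ (L : IntermediateField k F) (_ : IsResidueLift v L)
    (σ : F ≃ₐ[k] F) (_ : σ ∈ v.valuationSubring.decompositionSubgroup k),
    fixedVectors ρ (σ '' (L : Set F))

end Representations

namespace SmoothVariety

variable {k : Type u} [Field k] {F : Type v} [Field F] [Algebra k F]
  {W : Type w} [AddCommGroup W] [Module ℚ W]

/-- The set `𝔙(X)` for the component of `X` with generic point `x` and its function field embedded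
into `F` by `ι`: the discrete rank one valuations of `F`, trivial on `k`, whose restriction
to the function field is trivial or has the local ring of a prime divisor of the component as
valuation ring. -/
def divisorialValuations (X : SmoothVariety k) (x : X.scheme)
    (ι : X.scheme.residueField x →ₐ[k] F) : Set (RatValuation F) :=
  {v | IsDiscreteRankOne k v ∧
    ((∀ a : X.scheme.residueField x, a ≠ 0 → v (ι a) = 1) ∨
      ∃ (y : X.scheme) (h : x ⤳ y), coheight y = 1 ∧
        ∀ a : X.scheme.residueField x, v (ι a) ≤ 1 ↔
          ∃ b : X.scheme.presheaf.stalk y,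
            (X.scheme.presheaf.stalkSpecializes h ≫ X.scheme.residue x) b = a)}

variable (k F) in
/-- A choice of `k`-embeddings into `F` of the function fields at all generic points of all
smooth `k`-varieties. -/
abbrev EmbeddingChoice : Type (max (u + 1) v) :=
  ∀ (X : SmoothVariety k) (x : GenericPoint X), X.scheme.residueField x.1 →ₐ[k] F

/-- `𝒲` of the component of `X` with generic point `x`: the intersection of the vectors fixed by
all automorphisms over its function field with all `W_v` for `v ∈ 𝔙(X)`. -/
def componentSections (ρ : Representation ℚ (F ≃ₐ[k] F) W) (ι : EmbeddingChoice k F)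
    (X : SmoothVariety k) (x : GenericPoint X) : Submodule ℚ W :=
  fixedVectors ρ (Set.range (ι X x)) ⊓ ⨅ v ∈ divisorialValuations X x.1 (ι X x), localPart ρ v

/-- `𝒲(X)`: the product over the components. -/
abbrev Sections (ρ : Representation ℚ (F ≃ₐ[k] F) W) (ι : EmbeddingChoice k F)
    (X : SmoothVariety k) : Type (max u w) :=
  ∀ x : GenericPoint X, componentSections ρ ι X x

/-- The automorphism `τ` of `F` extends the embedding of function fields that is induced by `f` at
the generic point `x` of `U`. -/
def Extends (ι : EmbeddingChoice k F) {U X : SmoothVariety k} (f : U ⟶ X) (x : GenericPoint U)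
    (τ : F ≃ₐ[k] F) : Prop :=
  ∀ a : X.scheme.residueField (f.hom x.1),
    τ (ι X (Hom.onGeneric f x) a) = ι U x (f.hom.residueFieldMap x.1 a)

end SmoothVariety

end

/-! Since `F` is algebraically closed of infinite transcendence degree, any two embeddings of a
finitely generated field into `F` differ by an automorphism (`exists_algEquiv_extending`). A vector
fixed over `k(x)` is therefore the same as a `G`-equivariant function on the embeddings `k(x) → F`,
that is, on the generic geometric points of the component (`evalAt`). In these terms restriction
along `f` is composition of geometric points with `f` (`evalAt_restriction`), which makes
functoriality evident. Injectivity for a covering follows because generic geometric points of `X`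
lift to `U` (`exists_geomPoint_lift`).

For gluing, let `s` on `U` have equal restrictions to `U ×_X U`. Two generic geometric points of `U`
over the same point of `X` need not form a generic point of `U ×_X U`. A third point of the same
fibre, chosen generic over the compositum of their two fields, forms a generic pair with each of
them, because flat maps preserve generic points. Hence `s` takes the same value at all three
(`evalAt_eq_of_comp_eq`), and `s` descends to an equivariant function on generic geometric points of
`X`.

The valuation conditions are expressed by centres: `v` belongs to `𝔙(X, x)` exactly when it is of
the required type and is centred at a point of codimension at most one
(`mem_divisorialValuations_iff`). This rests on the local rings of smooth varieties in such
codimension being fields or discrete valuation rings, because smooth varieties are locally étale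
over affine space. Centres push forward along morphisms of the site, so restriction preserves the
conditions. Conversely, if `v` is centred at `y` on `X`, choose a generic point `u'` of the fibre of
`U` over `y`. The residue field of `v` is algebraically closed and has infinite transcendence
degree, so it receives `k(u')` over `k(y)`. A Hensel-type lifting for smooth algebras turns this
into a geometric point of `U`, over the given one, centred at `u'` (`exists_isCentered_lift`).
Evaluating `s` there shows that the descended vector lies in `W_v`.

Finally, coverings are stable under base change in the site (`IsCovering.exists_base_change`), so
exactness for single coverings gives the sheaf property. -/

/-! ### Embeddings into algebraically closed fields and their conjugacy -/

section FieldEmbeddings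

open Cardinal

theorem IsTranscendenceBasis.exists_algHom {K E Ω ι : Type*} [Field K] [Field E] [Field Ω]
    [Algebra K E] [Algebra K Ω] [IsAlgClosed Ω] {x : ι → E} (hx : IsTranscendenceBasis K x)
    {y : ι → Ω} (hy : AlgebraicIndependent K y) : ∃ φ : E →ₐ[K] Ω, ∀ i, φ (x i) = y i := by
  let A := Algebra.adjoin K (Set.range x)
  let g : A →ₐ[K] Ω := (MvPolynomial.aeval y).comp hx.1.aevalEquiv.symm.toAlgHom
  have hg : Function.Injective g := Function.Injective.comp (g := MvPolynomial.aeval y) hy hx.1.aevalEquiv.symm.injective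
  let : Algebra A Ω := g.toRingHom.toAlgebra
  have : IsScalarTower K A Ω := .of_algebraMap_eq fun r => (g.commutes r).symm
  have : Algebra.IsAlgebraic A E := hx.isAlgebraic
  have : FaithfulSMul A Ω := (faithfulSMul_iff_algebraMap_injective _ _).2 hg
  let φ : E →ₐ[A] Ω := IsAlgClosed.lift
  refine ⟨φ.restrictScalars K, fun i => ?_⟩
  have h1 : x i = algebraMap A E (hx.1.aevalEquiv (MvPolynomial.X i)) := by simp
  have h2 : φ (x i) = g (hx.1.aevalEquiv (MvPolynomial.X i)) := by
    rw [h1]; exact φ.commutes _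
  change φ (x i) = y i
  rw [h2]
  change MvPolynomial.aeval y (hx.1.aevalEquiv.symm (hx.1.aevalEquiv (MvPolynomial.X i))) = y i
  simp

theorem FinTrdeg.nonempty_algHom (K : Type*) (E : Type*) (Ω : Type*) [Field K] [Field E] [Field Ω]
    [Algebra K E] [Algebra K Ω] [IsAlgClosed Ω] [FinTrdeg K E]
    (hΩ : ℵ₀ ≤ Algebra.trdeg K Ω) : Nonempty (E →ₐ[K] Ω) := by
  obtain ⟨s, hs⟩ := exists_finset_isTranscendenceBasis K E
  obtain ⟨t, ht⟩ := exists_isTranscendenceBasis K Ω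
  rw [← ht.cardinalMk_eq_trdeg, Cardinal.aleph0_le_mk_iff] at hΩ
  obtain ⟨j⟩ : Nonempty (s ↪ t) :=
    ⟨(Finite.equivFin s).toEmbedding.trans ((Fin.valEmbedding).trans (Infinite.natEmbedding t))⟩
  obtain ⟨φ, -⟩ := hs.exists_algHom (ht.1.comp j j.injective)
  exact ⟨φ⟩

/-- A bijection of transcendence bases extends to an embedding `φ`. Its image is algebraically
closed and contains a transcendence basis of `F₂`, so it is everything. -/
theorem IsAlgClosed.nonempty_algEquiv_of_trdeg_eq (E : Type*) (F₁ F₂ : Type v) [Field E] [Field F₁]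
    [Field F₂] [Algebra E F₁] [Algebra E F₂] [IsAlgClosed F₁] [IsAlgClosed F₂]
    (h : Algebra.trdeg E F₁ = Algebra.trdeg E F₂) : Nonempty (F₁ ≃ₐ[E] F₂) := by
  obtain ⟨s, hs⟩ := exists_isTranscendenceBasis E F₁
  obtain ⟨t, ht⟩ := exists_isTranscendenceBasis E F₂
  rw [← hs.cardinalMk_eq_trdeg, ← ht.cardinalMk_eq_trdeg] at h
  obtain ⟨e⟩ := Cardinal.eq.1 h
  obtain ⟨φ, hφ⟩ := hs.exists_algHom (ht.1.comp e e.injective)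
  refine ⟨AlgEquiv.ofBijective φ ⟨φ.injective, ?_⟩⟩
  let : Algebra F₁ F₂ := φ.toRingHom.toAlgebra
  have hle : Algebra.adjoin E (Set.range ((↑) : t → F₂)) ≤ φ.range := by
    rw [Algebra.adjoin_le_iff]
    rintro _ ⟨i, rfl⟩
    exact ⟨e.symm i, (hφ _).trans (by simp)⟩
  have := ht.isAlgebraic
  have h3 : Algebra.IsAlgebraic F₁ F₂ := by
    refine ⟨fun a => ?_⟩
    have ha := Algebra.IsAlgebraic.isAlgebraic (R := Algebra.adjoin E (Set.range ((↑) : t → F₂))) a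
    obtain ⟨p, hp0, hp⟩ := ha
    choose g hg using fun b : Algebra.adjoin E (Set.range ((↑) : t → F₂)) => hle b.2
    let r : Algebra.adjoin E (Set.range ((↑) : t → F₂)) →+* F₁ :=
      (AlgEquiv.ofInjectiveField φ).symm.toRingHom.comp (Subalgebra.inclusion hle).toRingHom
    have hr : (algebraMap F₁ F₂).comp r = algebraMap _ F₂ := by
      ext b
      exact congrArg Subtype.val ((AlgEquiv.ofInjectiveField φ).apply_symm_apply (Subalgebra.inclusion hle b))
    refine ⟨p.map r, ?_, ?_⟩
    · refine (Polynomial.map_ne_zero_iff ?_).2 hp0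
      refine Function.Injective.of_comp (f := algebraMap F₁ F₂) ?_
      rw [← RingHom.coe_comp, hr]
      exact Subtype.val_injective
    · rw [Polynomial.aeval_def, Polynomial.eval₂_map, hr]
      exact hp
  exact (IsAlgClosed.algebraMap_bijective_of_isIntegral (k := F₁) (K := F₂)).2

theorem trdeg_eq_aleph0_of_finTrdeg {k : Type*} {E : Type*} {F : Type*} [Field k] [Field E]
    [Field F] [Algebra k E] [Algebra k F] [Algebra E F] [IsScalarTower k E F] [FinTrdeg k E]
    (hF : Algebra.trdeg k F = ℵ₀) : Algebra.trdeg E F = ℵ₀ := by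
  have h := lift_trdeg_add_eq k E F
  rw [hF, Cardinal.lift_aleph0] at h
  have h1 := trdeg_lt_aleph0 k E
  rw [← Cardinal.lift_inj, Cardinal.lift_aleph0]
  refine le_antisymm (h ▸ self_le_add_left _ _) (not_lt.1 fun h2 => ?_)
  exact (Cardinal.add_lt_aleph0 (Cardinal.lift_lt_aleph0.2 h1) h2).ne h

/-- Through either embedding, `F` is an algebraically closed extension of `E` of transcendence
degree `ℵ₀`, so the two extensions are isomorphic. This is the homogeneity of `F` behind every
transport of vectors below. -/
theorem exists_algEquiv_extending {k : Type*} {E : Type*} {F : Type*} [Field k] [Field E]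
    [Field F] [Algebra k E] [Algebra k F] [FinTrdeg k E] [IsAlgClosed F]
    (hF : Algebra.trdeg k F = ℵ₀) (a b : E →ₐ[k] F) :
    ∃ τ : F ≃ₐ[k] F, ∀ z, τ (a z) = b z := by
  -- The same field `F` carries two `E`-algebra structures, hence the explicit instance arguments.
  let A₁ : Algebra E F := a.toRingHom.toAlgebra
  let A₂ : Algebra E F := b.toRingHom.toAlgebra
  have S₁ : @IsScalarTower k E F _ A₁.toSMul _ :=
    @IsScalarTower.of_algebraMap_eq k E F _ _ _ _ A₁ _ fun r => (a.commutes r).symm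
  have S₂ : @IsScalarTower k E F _ A₂.toSMul _ :=
    @IsScalarTower.of_algebraMap_eq k E F _ _ _ _ A₂ _ fun r => (b.commutes r).symm
  obtain ⟨τ⟩ := @IsAlgClosed.nonempty_algEquiv_of_trdeg_eq E F F _ _ _ A₁ A₂ _ _
    ((@trdeg_eq_aleph0_of_finTrdeg k E F _ _ _ _ _ A₁ S₁ _ hF).trans
      (@trdeg_eq_aleph0_of_finTrdeg k E F _ _ _ _ _ A₂ S₂ _ hF).symm)
  have h : ∀ z, τ (a z) = b z := fun z => @AlgEquiv.commutes E F F _ _ _ A₁ A₂ τ z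
  exact ⟨AlgEquiv.ofRingEquiv (f := @AlgEquiv.toRingEquiv E F F _ _ _ A₁ A₂ τ) fun r => by
    exact (congrArg τ (a.commutes r).symm).trans ((h _).trans (b.commutes r)), h⟩

/-- The cardinality of `F` is at most `max #k ℵ₀`. A copy of `F` in the universe of `k` is needed to
speak of morphisms from its spectrum to varieties. -/
theorem small_of_trdeg_eq_aleph0 (k : Type u) (F : Type v) [Field k] [Field F] [Algebra k F]
    [IsAlgClosed F] (hF : Algebra.trdeg k F = ℵ₀) : Small.{u} F := by
  obtain ⟨s, hs⟩ := exists_isTranscendenceBasis k F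
  have h := IsAlgClosed.cardinal_le_max_transcendence_basis _ hs
  rw [hs.cardinalMk_eq_trdeg, hF] at h
  have h' : Cardinal.lift.{u} #F ≤ Cardinal.lift.{v} (max #k ℵ₀) := by
    rw [Cardinal.lift_umax.{v, u}] at h; simpa using h
  rw [← Cardinal.mk_out (max #k ℵ₀), Cardinal.lift_mk_le'] at h'
  obtain ⟨j⟩ := h'
  exact small_of_injective j.injective

end FieldEmbeddings

/-! ### Lifting along smooth algebras over valuation rings of algebraically closed fields -/

section HenselianLifting

open Polynomial

/-- Over `F` the value `f(x)` is the product of the `x - a` over the roots `a`, all of them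
integral. As the product has valuation less than one, some factor does. The residue root need not be
simple. -/
theorem ValuationSubring.exists_root_of_residue_root {F : Type*} [Field F] [IsAlgClosed F]
    (O : ValuationSubring F) (f : O[X]) (hf : f.Monic) (x : O)
    (hx : IsLocalRing.residue O (f.eval x) = 0) :
    ∃ r : O, f.eval r = 0 ∧ IsLocalRing.residue O r = IsLocalRing.residue O x := by
  have hs : Splits (f.map (algebraMap O F)) := IsAlgClosed.splits _
  have hm : (f.map (algebraMap O F)).Monic := hf.map _
  have hv : O.valuation (algebraMap O F (f.eval x)) < 1 :=
    (O.valuation_lt_one_iff _).1 ((IsLocalRing.residue_eq_zero_iff _).1 hx)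
  have he : algebraMap O F (f.eval x) =
      ((f.map (algebraMap O F)).roots.map fun a => algebraMap O F x - a).prod := by
    rw [← Polynomial.eval_map_apply, hs.eval_eq_prod_roots_of_monic hm]
  rw [he, map_multiset_prod, Multiset.map_map] at hv
  obtain ⟨a, ha, hav⟩ : ∃ a ∈ (f.map (algebraMap O F)).roots,
      O.valuation (algebraMap O F x - a) ≠ 1 := by
    by_contra! hcon
    refine hv.ne (Multiset.prod_eq_one fun b hb => ?_)
    obtain ⟨a, ha, rfl⟩ := Multiset.mem_map.1 hb
    exact hcon a ha
  have hr := (Polynomial.mem_roots'.1 ha).2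
  have hint : IsIntegral O a := ⟨f, hf, by rw [← Polynomial.eval_map]; exact hr⟩
  obtain ⟨r, rfl⟩ := IsIntegrallyClosed.isIntegral_iff.1 hint
  refine ⟨r, ?_, ?_⟩
  · apply FaithfulSMul.algebraMap_injective O F
    rw [map_zero, ← Polynomial.eval_map_apply]
    exact hr
  · have h1 : O.valuation ((x - r : O) : F) < 1 :=
      lt_of_le_of_ne (O.valuation_le_one _) (by simpa using hav)
    have h2 := (IsLocalRing.residue_eq_zero_iff _).2 ((O.valuation_lt_one_iff _).2 h1)
    rw [map_sub, sub_eq_zero] at h2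
    exact h2.symm

/-- Near the prime `ker ψ`, the algebra `B` is standard étale over a polynomial ring over `A`. The
polynomial variables can be lifted arbitrarily, and the étale generator by the preceding root
lifting. -/
theorem ValuationSubring.exists_lift_of_smooth {A B F : Type*} [CommRing A] [CommRing B]
    [Algebra A B] [Algebra.Smooth A B] [Field F] [IsAlgClosed F] (O : ValuationSubring F)
    (φ : A →+* O) (ψ : B →+* IsLocalRing.ResidueField O)
    (h : ψ.comp (algebraMap A B) = (IsLocalRing.residue O).comp φ) :
    ∃ θ : B →+* O, θ.comp (algebraMap A B) = φ ∧ (IsLocalRing.residue O).comp θ = ψ := by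
  have : (RingHom.ker ψ).IsPrime := RingHom.ker_isPrime ψ
  obtain ⟨f, hf, n, algM, hT, ⟨⟨P⟩⟩⟩ :=
    Algebra.IsSmoothAt.exists_isStandardEtale_mvPolynomial (R := A) (p := RingHom.ker ψ)
  let M := MvPolynomial (Fin n) A
  let C := Localization.Away f
  let ψ' : C →+* IsLocalRing.ResidueField O :=
    IsLocalization.Away.lift f (g := ψ) (isUnit_iff_ne_zero.2 hf)
  have hψ' : ∀ b, ψ' (algebraMap B C b) = ψ b := IsLocalization.Away.lift_eq f _
  choose t ht using fun i : Fin n =>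
    IsLocalRing.residue_surjective (R := O) (ψ' (algebraMap M C (MvPolynomial.X i)))
  let φ' : M →+* O := MvPolynomial.eval₂Hom φ t
  have hφ' : (IsLocalRing.residue O).comp φ' = ψ'.comp (algebraMap M C) := by
    refine MvPolynomial.ringHom_ext (fun a => ?_) fun i => ?_
    · have h1 : algebraMap M C (MvPolynomial.C a) = algebraMap B C (algebraMap A B a) := by
        rw [← IsScalarTower.algebraMap_apply A B C, IsScalarTower.algebraMap_apply A M C]
        rfl
      simp only [RingHom.comp_apply, h1, hψ']
      simpa [φ'] using (RingHom.congr_fun h a).symm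
    · simp only [RingHom.comp_apply, ← ht]
      simp [φ']
  obtain ⟨x, hx⟩ := IsLocalRing.residue_surjective (R := O) (ψ' P.x)
  have key : ∀ (p : M[X]) (y : O), IsLocalRing.residue O y = ψ' P.x →
      IsLocalRing.residue O ((p.map φ').eval y) = ψ' (aeval P.x p) := by
    intro p y hy
    rw [Polynomial.eval_map, Polynomial.hom_eval₂, Polynomial.aeval_def, Polynomial.hom_eval₂,
      hφ', hy]
  obtain ⟨r, hr0, hr⟩ := O.exists_root_of_residue_root (P.f.map φ') (P.monic_f.map _) x (by
    rw [key _ _ hx, P.hasMap.1, map_zero])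
  rw [hx] at hr
  let : Algebra M O := φ'.toAlgebra
  -- The element that must be invertible has non-zero residue, and `O` is local.
  have hmap : P.HasMap r := by
    refine ⟨by rw [aeval_def, ← Polynomial.eval_map]; exact hr0, ?_⟩
    have h1 : IsLocalRing.residue O (aeval r P.g) ≠ 0 := by
      rw [aeval_def, ← Polynomial.eval_map]
      refine (key P.g r hr).trans_ne ?_
      exact (P.hasMap.2.map ψ').ne_zero
    exact (IsLocalRing.residue_ne_zero_iff_isUnit _).1 h1
  let θ : C →ₐ[M] O := (P.lift r hmap).comp P.equivRing.toAlgHom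
  refine ⟨θ.toRingHom.comp (algebraMap B C), ?_, ?_⟩
  · ext a : 1
    have h1 : algebraMap B C (algebraMap A B a) = algebraMap M C (MvPolynomial.C a) := by
      rw [← IsScalarTower.algebraMap_apply A B C, IsScalarTower.algebraMap_apply A M C]
      rfl
    change θ (algebraMap B C (algebraMap A B a)) = φ a
    rw [h1, θ.commutes]
    exact MvPolynomial.eval₂Hom_C φ t a
  · let : Algebra M (IsLocalRing.ResidueField O) := ((IsLocalRing.residue O).comp φ').toAlgebra
    let θ₁ : C →ₐ[M] IsLocalRing.ResidueField O :=
      { (IsLocalRing.residue O).comp θ.toRingHom with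
        commutes' := fun m => congrArg (IsLocalRing.residue O) (θ.commutes m) }
    let θ₂ : C →ₐ[M] IsLocalRing.ResidueField O :=
      { ψ' with commutes' := fun m => (RingHom.congr_fun hφ' m).symm }
    -- Maps out of a standard étale algebra over `M` are determined by the image of its generator.
    have h2 : θ₁.comp P.equivRing.symm.toAlgHom = θ₂.comp P.equivRing.symm.toAlgHom := by
      refine StandardEtalePair.hom_ext ?_
      change IsLocalRing.residue O (P.lift r hmap (P.equivRing (P.equivRing.symm P.X))) =
        ψ' (P.equivRing.symm P.X)
      rw [AlgEquiv.apply_symm_apply, StandardEtalePair.lift_X, P.equivRing_symm_X, hr]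
    have h3 : θ₁ = θ₂ := by
      ext c
      have := DFunLike.congr_fun h2 (P.equivRing c)
      simpa using this
    ext b : 1
    exact (DFunLike.congr_fun h3 (algebraMap B C b)).trans (hψ' b)

end HenselianLifting

/-! ### Smooth local rings of dimension at most one -/

section CodimensionOne

open IsLocalRing

/-- By Krull's intersection theorem there is a last power of the maximal ideal containing `a`; its
cofactor is then a unit. -/
theorem IsLocalRing.exists_eq_mul_pow_of_maximalIdeal_eq_span {S : Type*} [CommRing S]
    [IsLocalRing S] [IsNoetherianRing S] {ϖ : S} (h : maximalIdeal S = Ideal.span {ϖ})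
    {a : S} (ha : a ≠ 0) : ∃ (n : ℕ) (c : Sˣ), a = c * ϖ ^ n := by
  have h1 : ∃ n, a ∉ maximalIdeal S ^ n := by
    by_contra! hcon
    refine ha ?_
    have := (Ideal.mem_iInf (R := S)).2 hcon
    rwa [Ideal.iInf_pow_eq_bot_of_isLocalRing _ (Ideal.IsPrime.ne_top inferInstance)] at this
  classical
  obtain ⟨n, hn⟩ : ∃ n, Nat.find h1 = n + 1 :=
    Nat.exists_eq_succ_of_ne_zero fun h0 => Nat.find_spec h1 (by simp [h0])
  have h2 : a ∈ maximalIdeal S ^ n := not_not.1 (Nat.find_min h1 (by omega))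
  have h3 : a ∉ maximalIdeal S ^ (n + 1) := hn ▸ Nat.find_spec h1
  rw [h, Ideal.span_singleton_pow, Ideal.mem_span_singleton'] at h2 h3
  obtain ⟨c, rfl⟩ := h2
  have hc : IsUnit c := by
    by_contra hc
    have : c ∈ maximalIdeal S := hc
    rw [h, Ideal.mem_span_singleton'] at this
    obtain ⟨d, rfl⟩ := this
    exact h3 ⟨d, by ring⟩
  exact ⟨n, hc.unit, rfl⟩

/-- The two alternatives for `ϖ` are those of a field and of a discrete valuation ring. Divisibility
is decided by comparing exponents of `ϖ`. -/
theorem IsLocalRing.isDomain_of_maximalIdeal_eq_span {S : Type*} [CommRing S]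
    [IsLocalRing S] [IsNoetherianRing S] {ϖ : S} (h : maximalIdeal S = Ideal.span {ϖ})
    (hϖ : ϖ = 0 ∨ ∀ s, ϖ * s = 0 → s = 0) : IsDomain S ∧ ∀ a b : S, a ∣ b ∨ b ∣ a := by
  have key : ∀ a : S, a ≠ 0 → ∃ (n : ℕ) (c : Sˣ), a = c * ϖ ^ n := fun a ha =>
    exists_eq_mul_pow_of_maximalIdeal_eq_span h ha
  refine ⟨?_, fun a b => ?_⟩
  · have : NoZeroDivisors S := by
      refine ⟨fun {a b} hab => ?_⟩
      by_contra! hne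
      obtain ⟨n, c, hc⟩ := key a hne.1
      have hb : ϖ ^ n * b = 0 := by
        rw [hc, mul_assoc] at hab
        exact (Units.mul_right_eq_zero c).1 hab
      rcases hϖ with h0 | h0
      · rcases Nat.eq_zero_or_pos n with rfl | hn
        · exact hne.2 (by simpa using hb)
        · exact hne.1 (by rw [hc, h0, zero_pow hn.ne', mul_zero])
      · clear hc
        induction n with
        | zero => exact hne.2 (by simpa using hb)
        | succ n ih => exact ih (h0 _ (by rw [← hb]; ring))
    exact NoZeroDivisors.to_isDomain S
  · rcases eq_or_ne a 0 with rfl | ha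
    · exact Or.inr (dvd_zero b)
    rcases eq_or_ne b 0 with rfl | hb
    · exact Or.inl (dvd_zero a)
    obtain ⟨n, c, rfl⟩ := key a ha
    obtain ⟨m, d, rfl⟩ := key b hb
    rcases le_total n m with hnm | hnm
    · exact Or.inl (by simpa using pow_dvd_pow ϖ hnm)
    · exact Or.inr (by simpa using pow_dvd_pow ϖ hnm)

theorem Ideal.exists_eq_span_singleton_of_height_le_one {A : Type*} [CommRing A] [IsDomain A]
    [UniqueFactorizationMonoid A] (p : Ideal A) [p.IsPrime] (hp : p.height ≤ 1) :
    ∃ π, p = Ideal.span {π} := by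
  rcases eq_or_ne p ⊥ with rfl | h0
  · exact ⟨0, by simp⟩
  obtain ⟨π, hπ, hprime⟩ := Ideal.IsPrime.exists_mem_prime_of_ne_bot ‹p.IsPrime› h0
  refine ⟨π, ?_⟩
  have h1 : (Ideal.span {π}).IsPrime := (Ideal.span_singleton_prime hprime.ne_zero).2 hprime
  have hle : Ideal.span {π} ≤ p := (Ideal.span_singleton_le_iff_mem _).2 hπ
  by_contra hne
  have hlt : Ideal.span {π} < p := lt_of_le_of_ne hle (Ne.symm hne)
  have hlt0 : (⊥ : Ideal A) < Ideal.span {π} := by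
    rw [bot_lt_iff_ne_bot, Ne, Ideal.span_singleton_eq_bot]
    exact hprime.ne_zero
  have hfin : (⊥ : Ideal A).FiniteHeight := ⟨Or.inr (by simp)⟩
  have hfin' : (Ideal.span {π}).FiniteHeight := ⟨Or.inr ((Ideal.height_mono hle).trans_lt
    (hp.trans_lt (by simp))).ne⟩
  have h2 := Ideal.height_strict_mono_of_isPrime hlt
  have h3 := Ideal.height_strict_mono_of_isPrime hlt0
  have h4 := Order.one_le_iff_pos.2 (pos_of_gt h3)
  exact (h4.trans_lt h2).not_ge hp

/-- Going down bounds the height of the prime of `A` below, which is then principal by factoriality.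
Its generator generates the maximal ideal of `S` because `S` is unramified, and is zero or a
non-zero-divisor because `S` is flat. -/
theorem IsLocalRing.isDomain_of_etale_of_height_le_one (A : Type*) {S : Type*} [CommRing A]
    [IsDomain A] [UniqueFactorizationMonoid A] [IsNoetherianRing A] [CommRing S] [IsLocalRing S]
    [IsNoetherianRing S] [Algebra A S] [Algebra.FormallyUnramified A S] [Module.Flat A S]
    [Algebra.EssFiniteType A S] (hS : (maximalIdeal S).height ≤ 1) :
    IsDomain S ∧ ∀ a b : S, a ∣ b ∨ b ∣ a := by
  let p := (maximalIdeal S).comap (algebraMap A S)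
  have hlo : (maximalIdeal S).LiesOver p := ⟨rfl⟩
  have hp : p.height ≤ 1 := by
    rw [Ideal.height_eq_height_add_of_liesOver_of_hasGoingDown p (maximalIdeal S)] at hS
    exact le_self_add.trans hS
  obtain ⟨π, hπ⟩ := p.exists_eq_span_singleton_of_height_le_one hp
  let Ap := Localization.AtPrime p
  let g : Ap →+* S := IsLocalization.lift (M := p.primeCompl) (g := algebraMap A S) fun y => by
    by_contra hy
    exact y.2 hy
  let : Algebra Ap S := g.toAlgebra
  have : IsScalarTower A Ap S := .of_algebraMap_eq fun a =>
    (IsLocalization.lift_eq (M := p.primeCompl) _ a).symm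
  have : Algebra.FormallyUnramified Ap S := .of_restrictScalars A _ _
  have : Algebra.EssFiniteType Ap S := .of_comp A _ _
  have hloc : IsLocalHom (algebraMap Ap S) := by
    refine ((local_hom_TFAE (algebraMap Ap S)).out 0 2).2 ?_
    rw [← Localization.AtPrime.map_eq_maximalIdeal, Ideal.map_map, ← IsScalarTower.algebraMap_eq,
      Ideal.map_le_iff_le_comap]
  have hmax := Algebra.FormallyUnramified.map_maximalIdeal (R := Ap) (S := S)
  rw [← Localization.AtPrime.map_eq_maximalIdeal, Ideal.map_map, ← IsScalarTower.algebraMap_eq,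
    hπ, Ideal.map_span, Set.image_singleton] at hmax
  refine isDomain_of_maximalIdeal_eq_span hmax.symm ?_
  rcases eq_or_ne π 0 with rfl | h0
  · exact Or.inl (map_zero _)
  · refine Or.inr fun s hs => ?_
    have := Module.Flat.isSMulRegular_of_nonZeroDivisors (M := S) (mem_nonZeroDivisors_of_ne_zero h0)
    exact this (by simpa [Algebra.smul_def] using hs)

/-- Locally `B` is étale over a polynomial ring over `k`, which is factorial and Noetherian. -/
theorem Algebra.Smooth.isDomain_localization_of_height_le_one (k : Type*) {B : Type*} [Field k]
    [CommRing B] [Algebra k B] [Algebra.Smooth k B] (q : Ideal B) [q.IsPrime] (hq : q.height ≤ 1)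
    (S : Type*) [CommRing S] [Algebra B S] [IsLocalization.AtPrime S q] :
    IsDomain S ∧ ∀ a b : S, a ∣ b ∨ b ∣ a := by
  obtain ⟨f, hf, n, algM, hT, hE⟩ :=
    Algebra.IsSmoothAt.exists_isStandardEtale_mvPolynomial (R := k) (p := q)
  let M := MvPolynomial (Fin n) k
  let C := Localization.Away f
  have : IsLocalRing S := IsLocalization.AtPrime.isLocalRing S q
  have : IsNoetherianRing B := Algebra.FiniteType.isNoetherianRing k B
  have : IsNoetherianRing S := IsLocalization.isNoetherianRing q.primeCompl S inferInstance
  let g : C →+* S := IsLocalization.Away.lift f (g := algebraMap B S)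
    (IsLocalization.map_units S (⟨f, hf⟩ : q.primeCompl))
  let : Algebra C S := g.toAlgebra
  have : IsScalarTower B C S := .of_algebraMap_eq fun b => (IsLocalization.Away.lift_eq f _ b).symm
  have hloc : IsLocalization (q.primeCompl.map (algebraMap B C)) S :=
    IsLocalization.isLocalization_of_submonoid_le C S (Submonoid.powers f) q.primeCompl
      (Submonoid.powers_le.2 hf)
  let : Algebra M S := ((algebraMap C S).comp (algebraMap M C)).toAlgebra
  have : IsScalarTower M C S := .of_algebraMap_eq fun _ => rfl
  have : Algebra.FormallyUnramified C S := .of_isLocalization (q.primeCompl.map (algebraMap B C))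
  have : Algebra.FormallyUnramified M S := .comp M C S
  have : Module.Flat C S := IsLocalization.flat S (q.primeCompl.map (algebraMap B C))
  have : Module.Flat M S := .trans M C S
  have : Algebra.EssFiniteType C S := .of_isLocalization S (q.primeCompl.map (algebraMap B C))
  have : Algebra.EssFiniteType M S := .comp M C S
  refine IsLocalRing.isDomain_of_etale_of_height_le_one M ?_
  rw [← WithBot.coe_le_coe, IsLocalRing.maximalIdeal_height_eq_ringKrullDim,
    IsLocalization.AtPrime.ringKrullDim_eq_height q S]
  exact_mod_cast hq

end CodimensionOne

/-! ### Residue fields of the valuations of `F` -/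

section ResidueFields

open Cardinal IntermediateField

instance ValuationSubring.isAlgClosed_residueField {F : Type*} [Field F] [IsAlgClosed F]
    (O : ValuationSubring F) : IsAlgClosed (IsLocalRing.ResidueField O) := by
  refine IsAlgClosed.of_exists_root _ fun p hp hirr => ?_
  obtain ⟨f, hf, hdeg, hmon⟩ := Polynomial.lifts_and_natDegree_eq_and_monic
    ((Polynomial.map_surjective _ (IsLocalRing.residue_surjective (R := O)) p :
      p ∈ Polynomial.lifts (IsLocalRing.residue O))) hp
  have hd : (f.map (algebraMap O F)).degree ≠ 0 := by
    rw [hmon.degree_map, Polynomial.degree_eq_natDegree hmon.ne_zero, hdeg]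
    exact_mod_cast hirr.natDegree_pos.ne'
  obtain ⟨a, ha⟩ := IsAlgClosed.exists_root _ hd
  have hint : IsIntegral O a := ⟨f, hmon, by rw [← Polynomial.eval_map]; exact ha⟩
  obtain ⟨r, rfl⟩ := IsIntegrallyClosed.isIntegral_iff.1 hint
  refine ⟨IsLocalRing.residue O r, ?_⟩
  have hr : f.eval r = 0 := by
    apply FaithfulSMul.algebraMap_injective O F
    rw [map_zero, ← Polynomial.eval_map_apply]
    exact ha
  rw [← hf, Polynomial.eval_map_apply, hr, map_zero]

theorem aleph0_le_trdeg_of_finTrdeg (k : Type*) (E : Type*) (Ω : Type*) [Field k] [Field E]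
    [Field Ω] [Algebra k E] [Algebra k Ω] [Algebra E Ω] [IsScalarTower k E Ω] [FinTrdeg k E]
    (h : ℵ₀ ≤ Algebra.trdeg k Ω) : ℵ₀ ≤ Algebra.trdeg E Ω := by
  by_contra! hlt
  have := finTrdeg_iff_trdeg.2 hlt
  have := FinTrdeg.trans k E Ω
  exact (trdeg_lt_aleph0 k Ω).not_ge h

theorem FinTrdeg.of_tower (k : Type*) (E : Type*) (E' : Type*) [Field k] [Field E]
    [Field E'] [Algebra k E] [Algebra k E'] [Algebra E E'] [IsScalarTower k E E']
    [FinTrdeg k E'] : FinTrdeg E E' ∧ FinTrdeg k E := by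
  have h := lift_trdeg_add_eq k E E'
  have h1 := Cardinal.lift_lt_aleph0.2 (trdeg_lt_aleph0 k E')
  rw [← h, Cardinal.add_lt_aleph0_iff, Cardinal.lift_lt_aleph0, Cardinal.lift_lt_aleph0] at h1
  exact ⟨finTrdeg_iff_trdeg.2 h1.2, finTrdeg_iff_trdeg.2 h1.1⟩

/-- Applied both with `Ω = F` and with `Ω` the residue field of a valuation of `F`. -/
theorem exists_algHom_extending {k : Type*} {E : Type*} {E' : Type*} {Ω : Type*} [Field k]
    [Field E] [Field E'] [Field Ω] [Algebra k E] [Algebra k E'] [Algebra k Ω] [FinTrdeg k E']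
    [IsAlgClosed Ω] (hΩ : ℵ₀ ≤ Algebra.trdeg k Ω) (f : E →ₐ[k] E') (a : E →ₐ[k] Ω) :
    ∃ b : E' →ₐ[k] Ω, b.comp f = a := by
  let : Algebra E E' := f.toRingHom.toAlgebra
  let : Algebra E Ω := a.toRingHom.toAlgebra
  have : IsScalarTower k E E' := .of_algebraMap_eq fun r => (f.commutes r).symm
  have : IsScalarTower k E Ω := .of_algebraMap_eq fun r => (a.commutes r).symm
  obtain ⟨h1, h2⟩ := FinTrdeg.of_tower k E E'
  obtain ⟨b⟩ := FinTrdeg.nonempty_algHom E E' Ω (aleph0_le_trdeg_of_finTrdeg k E Ω hΩ)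
  exact ⟨b.restrictScalars k, AlgHom.ext fun z => b.commutes z⟩

variable {k : Type u} [Field k] {F : Type v} [Field F] [Algebra k F]

/-- The value group has rational rank one, so its lifting contributes a single transcendental at
most: `F` is algebraic over `L(t)`, where `t` lifts `1 ∈ ℚ`. -/
theorem IsResidueLift.finTrdeg {v : RatValuation F} {L : IntermediateField k F}
    (h : IsResidueLift v L) : FinTrdeg L F := by
  obtain ⟨s, hs, halg⟩ := h.algebraic
  let t : F := s (Multiplicative.ofAdd 1)
  refine ⟨L⟮t⟯, fg_adjoin_of_finite (Set.finite_singleton t), ?_⟩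
  let D := algebraicClosure L⟮t⟯ F
  have hD : ∀ a, a ∈ D ↔ IsAlgebraic L⟮t⟯ a := fun a => mem_algebraicClosure_iff
  have hle : adjoin k ((L : Set F) ∪ Set.range fun q => (s q : F)) ≤
      (D.restrictScalars L).restrictScalars k := by
    rw [adjoin_le_iff, Set.union_subset_iff]
    constructor
    · intro a ha
      exact (hD a).2 (isAlgebraic_algebraMap (⟨a, L⟮t⟯.algebraMap_mem ⟨a, ha⟩⟩ : L⟮t⟯))
    · rintro _ ⟨q, rfl⟩
      refine (hD _).2 ?_
      -- For `q = m / n` one has `s(q) ^ n = s(1) ^ m`.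
      have hq : ((s q : Fˣ) : F) ^ (Multiplicative.toAdd q).den =
          ((s (Multiplicative.ofAdd 1) ^ (Multiplicative.toAdd q).num : Fˣ) : F) := by
        rw [← Units.val_pow_eq_pow_val, ← map_pow, ← map_zpow]
        congr 2
        apply Multiplicative.toAdd.injective
        simp [toAdd_pow, toAdd_zpow, Rat.den_mul_eq_num]
      refine IsAlgebraic.of_pow (Rat.den_pos (Multiplicative.toAdd q)) ?_
      rw [hq, Units.val_zpow_eq_zpow_val]
      have ht : t ∈ L⟮t⟯ := mem_adjoin_simple_self L t
      exact isAlgebraic_algebraMap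
        (⟨_, zpow_mem ht (Multiplicative.toAdd q).num⟩ : L⟮t⟯)
  refine ⟨fun a => ?_⟩
  let g : adjoin k ((L : Set F) ∪ Set.range fun q => (s q : F)) →+* D :=
    (inclusion hle).toRingHom
  have ha : IsAlgebraic D (RingHom.id F a) :=
    (halg.isAlgebraic a).ringHom_of_comp_eq g (RingHom.id F) g.injective rfl
  exact ha.restrictScalars L⟮t⟯

theorem IsDiscreteRankOne.algebraMap_le_one {v : RatValuation F} (hv : IsDiscreteRankOne k v)
    (a : k) : v (algebraMap k F a) ≤ 1 := by
  rcases eq_or_ne a 0 with rfl | ha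
  · simp
  · exact (hv.trivial a ha).le

/-- The structure map of the valuation ring of a valuation that is trivial on `k`. -/
noncomputable def IsDiscreteRankOne.baseHom {v : RatValuation F} (hv : IsDiscreteRankOne k v) :
    k →+* v.valuationSubring :=
  (algebraMap k F).codRestrict v.valuationSubring hv.algebraMap_le_one

/-- The residue field of a valuation that is trivial on `k` is an extension of `k`. -/
@[reducible]
noncomputable def IsDiscreteRankOne.residueAlgebra {v : RatValuation F} (hv : IsDiscreteRankOne k v) :
    Algebra k (IsLocalRing.ResidueField v.valuationSubring) :=
  ((IsLocalRing.residue v.valuationSubring).comp hv.baseHom).toAlgebra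

/-- The lifting `L` embeds into the residue field, and it has infinite transcendence degree since
`F` has finite transcendence degree over it. This leaves room in the residue field for residue
fields of points of varieties. -/
theorem IsDiscreteRankOne.aleph0_le_trdeg {v : RatValuation F} (hv : IsDiscreteRankOne k v)
    (hF : Algebra.trdeg k F = ℵ₀) :
    let := hv.residueAlgebra
    ℵ₀ ≤ Algebra.trdeg k (IsLocalRing.ResidueField v.valuationSubring) := by
  intro
  obtain ⟨L, hL⟩ := hv.lift
  have := hL.finTrdeg
  have h : ℵ₀ ≤ Algebra.trdeg k L := by
    by_contra! hlt
    have := finTrdeg_iff_trdeg.2 hlt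
    have := FinTrdeg.trans k L F
    exact (trdeg_lt_aleph0 k F).ne hF
  let g : L →ₐ[k] IsLocalRing.ResidueField v.valuationSubring :=
    { (IsLocalRing.residue v.valuationSubring).comp
        ((algebraMap L F).codRestrict v.valuationSubring fun a => hL.integral a a.2) with
      commutes' := fun r => rfl }
  exact h.trans (trdeg_le_of_injective g g.injective)

end ResidueFields

/-! ### Equivariance of fixed vectors and of `W_v` -/

section Equivariance

open IntermediateField
open scoped Pointwise

variable {k : Type u} [Field k] {F : Type v} [Field F] [Algebra k F]
  {W : Type w} [AddCommGroup W] [Module ℚ W]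

theorem mem_fixedVectors_iff {ρ : Representation ℚ (F ≃ₐ[k] F) W} {S : Set F} {x : W} :
    x ∈ fixedVectors ρ S ↔ ∀ σ : F ≃ₐ[k] F, (∀ a ∈ S, σ a = a) → ρ σ x = x := by
  constructor
  · intro h σ hσ
    exact h ⟨σ, mem_fixingSubgroup_iff (M := F ≃ₐ[k] F) |>.2 hσ⟩
  · intro h σ
    exact h σ.1 (mem_fixingSubgroup_iff (M := F ≃ₐ[k] F) |>.1 σ.2)

theorem map_mem_fixedVectors {ρ : Representation ℚ (F ≃ₐ[k] F) W} {S T : Set F} {x : W}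
    (hx : x ∈ fixedVectors ρ S) (τ : F ≃ₐ[k] F) (h : ∀ a ∈ S, τ a ∈ T) :
    ρ τ x ∈ fixedVectors ρ T := by
  rw [mem_fixedVectors_iff] at hx ⊢
  intro σ hσ
  have h1 := hx (τ⁻¹ * σ * τ) fun a ha => by
    change τ.symm (σ (τ a)) = a
    rw [hσ _ (h a ha), AlgEquiv.symm_apply_apply]
  rw [← Module.End.mul_apply, ← map_mul]
  nth_rw 2 [← h1]
  rw [← Module.End.mul_apply, ← map_mul]
  congr 2
  group

/-- The valuation `v ∘ τ`. -/
abbrev RatValuation.comp (v : RatValuation F) (τ : F ≃ₐ[k] F) : RatValuation F :=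
  v.comap (τ : F →+* F)

theorem IsResidueLift.comp {v : RatValuation F} {L : IntermediateField k F}
    (h : IsResidueLift v L) (τ : F ≃ₐ[k] F) :
    IsResidueLift (v.comp τ) (L.map (τ.symm : F →ₐ[k] F)) := by
  refine ⟨?_, ?_, ?_⟩
  · rintro _ ⟨a, ha, rfl⟩
    exact (congrArg v (τ.apply_symm_apply a)).trans_le (h.integral a ha)
  · intro a ha
    obtain ⟨b, hb, hab⟩ := h.surj (τ a) ha
    refine ⟨τ.symm b, ⟨b, hb, rfl⟩, ?_⟩
    change v (τ (a - τ.symm b)) < 1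
    rwa [map_sub, AlgEquiv.apply_symm_apply]
  · obtain ⟨s, hs, halg⟩ := h.algebraic
    refine ⟨(Units.map (τ.symm : F →* F)).comp s, fun q => ?_, ?_⟩
    · exact (congrArg v (τ.apply_symm_apply _)).trans (hs q)
    · have he : adjoin k (((L.map (τ.symm : F →ₐ[k] F) : IntermediateField k F) : Set F) ∪
          Set.range fun q => (((Units.map (τ.symm : F →* F)).comp s q : Fˣ) : F)) =
          (adjoin k ((L : Set F) ∪ Set.range fun q => (s q : F))).map (τ.symm : F →ₐ[k] F) := by
        rw [adjoin_map, Set.image_union, ← Set.range_comp]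
        rfl
      rw [he]
      exact halg.ringHom_of_comp_eq
        (intermediateFieldMap τ.symm (adjoin k ((L : Set F) ∪ Set.range fun q => (s q : F))))
        (τ.symm : F →+* F) (AlgEquiv.injective _) τ.symm.surjective rfl

theorem IsDiscreteRankOne.comp {v : RatValuation F} (h : IsDiscreteRankOne k v) (τ : F ≃ₐ[k] F) :
    IsDiscreteRankOne k (v.comp τ) := by
  refine ⟨fun a ha => ?_, fun q => ?_, ?_⟩
  · exact (congrArg v (τ.commutes a)).trans (h.trivial a ha)
  · obtain ⟨a, ha⟩ := h.surj q
    exact ⟨τ.symm a, (congrArg v (τ.apply_symm_apply a)).trans ha⟩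
  · obtain ⟨L, hL⟩ := h.lift
    exact ⟨_, hL.comp τ⟩

/-- Transport of structure: `τ⁻¹` carries residue liftings for `v` to those for `v ∘ τ`, and
conjugation by it carries one decomposition group to the other. -/
theorem map_symm_mem_localPart_comp {ρ : Representation ℚ (F ≃ₐ[k] F) W} {v : RatValuation F}
    {x : W} (hx : x ∈ localPart ρ v) (τ : F ≃ₐ[k] F) :
    ρ τ⁻¹ x ∈ localPart ρ (v.comp τ) := by
  suffices localPart ρ v ≤ (localPart ρ (v.comp τ)).comap (ρ τ⁻¹) from this hx
  refine iSup_le fun L => iSup_le fun hL => iSup_le fun σ => iSup_le fun hσ y hy => ?_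
  have hO : (v.comp τ).valuationSubring = τ⁻¹ • v.valuationSubring := by
    ext a
    rw [ValuationSubring.mem_inv_pointwise_smul_iff]
    rfl
  have hσ' : τ⁻¹ * σ * τ ∈ (v.comp τ).valuationSubring.decompositionSubgroup k := by
    rw [MulAction.mem_stabilizer_iff, hO, mul_smul, smul_inv_smul, mul_smul,
      MulAction.mem_stabilizer_iff.1 hσ]
  refine (le_iSup_of_le _ <| le_iSup_of_le (hL.comp τ) <| le_iSup_of_le _ <|
    le_iSup_of_le hσ' le_rfl : _ ≤ localPart ρ (v.comp τ)) ?_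
  refine map_mem_fixedVectors hy τ⁻¹ ?_
  rintro _ ⟨a, ha, rfl⟩
  refine ⟨τ.symm a, ⟨a, ha, rfl⟩, ?_⟩
  change τ.symm (σ (τ (τ.symm a))) = τ.symm (σ a)
  rw [AlgEquiv.apply_symm_apply]

theorem mem_localPart_comp_iff {ρ : Representation ℚ (F ≃ₐ[k] F) W} {v : RatValuation F}
    {x : W} (τ : F ≃ₐ[k] F) : x ∈ localPart ρ (v.comp τ) ↔ ρ τ x ∈ localPart ρ v := by
  constructor
  · intro h
    have h1 := map_symm_mem_localPart_comp h τ⁻¹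
    have h2 : (v.comp τ).comp τ⁻¹ = v := by
      ext a
      exact congrArg v (τ.apply_symm_apply a)
    rwa [inv_inv, h2] at h1
  · intro h
    have h1 := map_symm_mem_localPart_comp h τ
    rwa [← Module.End.mul_apply, ← map_mul, inv_mul_cancel, map_one, Module.End.one_apply] at h1

end Equivariance

/-! ### Codimension and generic points of fibres -/

section Codimension

/-- The prime `p` is minimal over an ideal with `height p` generators. Their images generate an
ideal over which `P` is minimal, and Krull's height theorem applies. -/
theorem Ideal.height_le_height_of_mem_minimalPrimes_map {R S : Type*} [CommRing R] [CommRing S]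
    [Algebra R S] [IsNoetherianRing R] [IsNoetherianRing S] (p : Ideal R) [p.IsPrime]
    (P : Ideal S) [P.LiesOver p] (hP : P ∈ (p.map (algebraMap R S)).minimalPrimes) :
    P.height ≤ p.height := by
  have hPp : P.IsPrime := hP.1.1
  obtain ⟨s, hs, hcard⟩ := p.exists_finset_card_eq_height_of_isNoetherianRing
  rw [← hcard]
  classical
  have hmin : P ∈ (Ideal.span ((s.image (algebraMap R S) : Finset S) : Set S)).minimalPrimes := by
    have hmap : Ideal.span ((s.image (algebraMap R S) : Finset S) : Set S) =
        (Ideal.span (s : Set R)).map (algebraMap R S) := by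
      rw [Ideal.map_span, Finset.coe_image]
    rw [hmap]
    refine ⟨⟨hPp, (Ideal.map_mono hs.1.2).trans hP.1.2⟩, fun Q hQ hQP => ?_⟩
    have hQp := hQ.1
    have h1 : Q.comap (algebraMap R S) ≤ p := by
      rw [Ideal.LiesOver.over (P := P) (p := p)]
      exact Ideal.comap_mono hQP
    have h2 : p ≤ Q.comap (algebraMap R S) :=
      hs.2 ⟨Ideal.comap_isPrime _ _, Ideal.map_le_iff_le_comap.1 hQ.2⟩ h1
    exact hP.2 ⟨hQp, Ideal.map_le_iff_le_comap.2 h2⟩ hQP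
  refine (Ideal.height_le_card_of_mem_minimalPrimes_span_finset hmin).trans ?_
  exact_mod_cast Finset.card_image_le

namespace AlgebraicGeometry

theorem Scheme.coheight_lt_top {X : Scheme.{u}} [IsLocallyNoetherian X] (x : X) :
    coheight x < ⊤ := by
  have h := ringKrullDim_stalk_eq_coheight x
  have h1 : ringKrullDim (X.presheaf.stalk x) < ⊤ := ringKrullDim_lt_top
  rw [h] at h1
  exact WithBot.coe_lt_coe.1 h1

theorem Scheme.height_maximalIdeal_stalk {X : Scheme.{u}} (x : X) :
    (IsLocalRing.maximalIdeal (X.presheaf.stalk x)).height = coheight x := by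
  rw [← WithBot.coe_inj, IsLocalRing.maximalIdeal_height_eq_ringKrullDim,
    ringKrullDim_stalk_eq_coheight]

theorem Scheme.lt_of_specializes_of_ne {X : Scheme.{u}} {x y : X} (h : y ⤳ x) (hne : y ≠ x) :
    x < y :=
  lt_of_le_not_ge h fun h' => hne (h.antisymm h').eq

/-- Coheights are finite and drop strictly under proper generalization. With `p` the membership in a
fibre, this produces generic points of fibres. -/
theorem Scheme.exists_specializes_maximal {X : Scheme.{u}} [IsLocallyNoetherian X] (p : X → Prop)
    {x₀ : X} (h₀ : p x₀) : ∃ x, x ⤳ x₀ ∧ p x ∧ ∀ x', x' ⤳ x → p x' → x' = x := by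
  obtain ⟨x, ⟨hx, hpx⟩, hmin⟩ := WellFounded.has_min
    (InvImage.wf (fun x : X => coheight x) (wellFounded_lt (α := ℕ∞)))
    {x | x ⤳ x₀ ∧ p x} ⟨x₀, specializes_rfl, h₀⟩
  refine ⟨x, hx, hpx, fun x' hx' hp' => ?_⟩
  by_contra hne
  exact hmin x' ⟨hx'.trans hx, hp'⟩
    (coheight_strictAnti (lt_of_specializes_of_ne hx' hne) (coheight_lt_top x'))

theorem Scheme.coheight_eq_zero_iff {X : Scheme.{u}} {x : X} :
    coheight x = 0 ↔ ∀ x', x' ⤳ x → x' = x := by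
  rw [Order.coheight_eq_zero]
  exact ⟨fun h x' hx' => (hx'.antisymm (h hx')).eq, fun h x' hx' => (h x' hx').le⟩

theorem Scheme.eq_of_specializes {X : Scheme.{u}} {x y : X} (hx : coheight x = 0) (h : y ⤳ x) :
    y = x :=
  coheight_eq_zero_iff.1 hx y h

theorem Scheme.exists_specializes_coheight_eq_zero {X : Scheme.{u}} [IsLocallyNoetherian X]
    (x₀ : X) : ∃ x, x ⤳ x₀ ∧ coheight x = 0 := by
  obtain ⟨x, hx, -, h⟩ := exists_specializes_maximal (fun _ => True) (x₀ := x₀) trivial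
  exact ⟨x, hx, coheight_eq_zero_iff.2 fun x' hx' => h x' hx' trivial⟩

/-- Points that are generic in their fibre do not have larger codimension than their image. -/
theorem Scheme.Hom.coheight_le_of_generic_in_fibre {X Y : Scheme.{u}} [IsLocallyNoetherian X]
    [IsLocallyNoetherian Y] (f : X ⟶ Y) (x : X)
    (hx : ∀ x', x' ⤳ x → f x' = f x → x' = x) : coheight x ≤ coheight (f x) := by
  rw [← Scheme.height_maximalIdeal_stalk, ← Scheme.height_maximalIdeal_stalk]
  let : Algebra (Y.presheaf.stalk (f x)) (X.presheaf.stalk x) := (f.stalkMap x).hom.toAlgebra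
  have hloc : IsLocalHom (f.stalkMap x).hom := inferInstance
  have hcomap : IsLocalHom (f.stalkMap x).hom ↔
      (IsLocalRing.maximalIdeal (X.presheaf.stalk x)).comap (f.stalkMap x).hom =
        IsLocalRing.maximalIdeal (Y.presheaf.stalk (f x)) :=
    (IsLocalRing.local_hom_TFAE (f.stalkMap x).hom).out 0 4
  have hmap : IsLocalHom (f.stalkMap x).hom ↔
      (IsLocalRing.maximalIdeal (Y.presheaf.stalk (f x))).map (f.stalkMap x).hom ≤
        IsLocalRing.maximalIdeal (X.presheaf.stalk x) :=
    (IsLocalRing.local_hom_TFAE (f.stalkMap x).hom).out 0 2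
  have hlo : (IsLocalRing.maximalIdeal (X.presheaf.stalk x)).LiesOver
      (IsLocalRing.maximalIdeal (Y.presheaf.stalk (f x))) :=
    ⟨(hcomap.mp hloc).symm⟩
  refine Ideal.height_le_height_of_mem_minimalPrimes_map _ _ ⟨⟨inferInstance, ?_⟩, ?_⟩
  · exact hmap.1 hloc
  · intro Q ⟨hQ, hQm⟩ hle
    -- A prime containing the extended maximal ideal is a generalization of `x` in the same fibre,
    -- hence `x` itself.
    let q : Spec (X.presheaf.stalk x) := ⟨Q, hQ⟩
    have h1 : (Spec.map (f.stalkMap x)) q = IsLocalRing.closedPoint _ := by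
      apply PrimeSpectrum.ext
      exact ((IsLocalRing.maximalIdeal.isMaximal _).eq_of_le
        (Ideal.comap_ne_top _ hQ.ne_top) (Ideal.map_le_iff_le_comap.1 hQm)).symm
    have h2 : f (X.fromSpecStalk x q) = f x := by
      rw [← Scheme.Hom.comp_apply, ← Scheme.SpecMap_stalkMap_fromSpecStalk,
        Scheme.Hom.comp_apply, h1, Scheme.fromSpecStalk_closedPoint]
    have h3 : X.fromSpecStalk x q ⤳ x := by
      have : X.fromSpecStalk x q ∈ Set.range (X.fromSpecStalk x) := ⟨q, rfl⟩
      rwa [Scheme.range_fromSpecStalk] at this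
    have h4 := hx _ h3 h2
    have h5 : q = IsLocalRing.closedPoint _ := by
      apply (X.fromSpecStalk x).isEmbedding.injective
      rw [h4, Scheme.fromSpecStalk_closedPoint]
    exact (congrArg PrimeSpectrum.asIdeal h5).ge

end AlgebraicGeometry

end Codimension

/-! ### Local rings and function fields of smooth varieties -/

section LocalRings

/-- The kernel of `R → Sq` is a prime inside `p`, hence equals `p` by minimality. So `Sp` is the
fraction field of `Sq`. -/
theorem IsLocalization.AtPrime.field_of_minimal_of_isDomain {R Sq Sp : Type*} [CommRing R]
    [CommRing Sq] [CommRing Sp] [Algebra R Sq] [Algebra R Sp] (p q : Ideal R) [p.IsPrime]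
    [q.IsPrime] [IsLocalization.AtPrime Sq q] [IsLocalization.AtPrime Sp p]
    (hp : p ∈ minimalPrimes R) [IsDomain Sq] (g : Sq →+* Sp)
    (hg : ∀ r, g (algebraMap R Sq r) = algebraMap R Sp r) :
    Function.Injective g ∧ IsField Sp ∧
      ∀ z : Sp, ∃ a b : Sq, b ≠ 0 ∧ g b * z = g a := by
  have hpq : p ≤ q := by
    intro r hr
    by_contra hrq
    have h1 : IsUnit (algebraMap R Sq r) := (IsLocalization.AtPrime.isUnit_to_map_iff Sq q r).2 hrq
    have h2 := h1.map g
    rw [hg] at h2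
    exact (IsLocalization.AtPrime.isUnit_to_map_iff Sp p r).1 h2 hr
  have hker : p ≤ RingHom.ker (algebraMap R Sq) := by
    refine hp.2 ⟨RingHom.ker_isPrime _, bot_le⟩ fun r hr => ?_
    obtain ⟨s, hs⟩ := (IsLocalization.map_eq_zero_iff q.primeCompl Sq r).1 hr
    exact (Ideal.IsPrime.mem_or_mem ‹_› (by rw [hs]; exact p.zero_mem : (s : R) * r ∈ p)).resolve_left
      fun h => s.2 (hpq h)
  have hker' : ∀ r ∈ p, algebraMap R Sp r = 0 := fun r hr => by
    rw [← hg, show algebraMap R Sq r = 0 from hker hr, map_zero]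
  have hinj : Function.Injective g := by
    rw [injective_iff_map_eq_zero]
    intro a ha
    obtain ⟨r, s, rfl⟩ := IsLocalization.exists_mk'_eq q.primeCompl a
    have h1 : algebraMap R Sp r = 0 := by
      rw [← hg, ← IsLocalization.mk'_spec Sq r s, map_mul, ha, zero_mul]
    obtain ⟨t, ht⟩ := (IsLocalization.map_eq_zero_iff p.primeCompl Sp r).1 h1
    have h2 : r ∈ p :=
      (Ideal.IsPrime.mem_or_mem ‹_› (by rw [ht]; exact p.zero_mem : (t : R) * r ∈ p)).resolve_left
        fun h => t.2 h
    rw [IsLocalization.mk'_eq_zero_iff]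
    obtain ⟨c, hc⟩ := (IsLocalization.map_eq_zero_iff q.primeCompl Sq r).1 (hker h2)
    exact ⟨c, hc⟩
  have : Nontrivial Sp := (IsLocalization.AtPrime.isLocalRing Sp p).toNontrivial
  refine ⟨hinj, ⟨exists_pair_ne Sp, mul_comm, fun {z} hz => ?_⟩, fun z => ?_⟩
  · obtain ⟨r, s, rfl⟩ := IsLocalization.exists_mk'_eq p.primeCompl z
    have hr : r ∉ p := fun h => hz (by
      rw [IsLocalization.mk'_eq_iff_eq_mul, hker' r h, zero_mul])
    exact ((IsLocalization.AtPrime.isUnit_mk'_iff Sp p r s).2 hr).exists_right_inv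
  · obtain ⟨r, s, rfl⟩ := IsLocalization.exists_mk'_eq p.primeCompl z
    refine ⟨algebraMap R Sq r, algebraMap R Sq s, fun h0 => ?_, ?_⟩
    · have h1 : algebraMap R Sp s = 0 := by rw [← hg, h0, map_zero]
      exact (IsLocalization.map_units Sp s).ne_zero h1
    · rw [hg, hg, mul_comm, IsLocalization.mk'_spec]

end LocalRings

namespace SmoothVariety

variable {k : Type u} [Field k]

instance (X : SmoothVariety k) : IsLocallyNoetherian X.scheme :=
  have : IsLocallyNoetherian (Spec (CommRingCat.of k)) := inferInstance
  LocallyOfFiniteType.isLocallyNoetherian X.str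

theorem exists_smooth_chart (X : SmoothVariety k) (y : X.scheme) :
    ∃ (V : X.scheme.Opens) (_ : IsAffineOpen V) (_ : y ∈ V) (φ : k →+* Γ(X.scheme, V)),
      φ.Smooth := by
  obtain ⟨_, ⟨V, hV, rfl⟩, hyV, -⟩ :=
    X.scheme.isBasis_affineOpens.exists_subset_of_mem_open (Set.mem_univ y) isOpen_univ
  refine ⟨V, hV, hyV, (Spec.preimage (hV.fromSpec ≫ X.str)).hom, ?_⟩
  rw [← HasRingHomProperty.Spec_iff (P := @Smooth), Spec.map_preimage]
  have : IsOpenImmersion hV.fromSpec := hV.isOpenImmersion_fromSpec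
  have : Smooth hV.fromSpec := inferInstance
  exact smooth_comp _ _

theorem isDomain_stalk (X : SmoothVariety k) {y : X.scheme} (hy : coheight y ≤ 1) :
    IsDomain (X.scheme.presheaf.stalk y) ∧
      ∀ a b : X.scheme.presheaf.stalk y, a ∣ b ∨ b ∣ a := by
  obtain ⟨V, hV, hyV, φ, hφ⟩ := X.exists_smooth_chart y
  algebraize [φ]
  let := X.scheme.presheaf.algebra_section_stalk ⟨y, hyV⟩
  have := hV.isLocalization_stalk ⟨y, hyV⟩
  refine Algebra.Smooth.isDomain_localization_of_height_le_one k
    (hV.primeIdealOf ⟨y, hyV⟩).asIdeal ?_ _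
  rw [← WithBot.coe_le_coe, ← IsLocalization.AtPrime.ringKrullDim_eq_height _
    (X.scheme.presheaf.stalk y), ringKrullDim_stalk_eq_coheight]
  exact_mod_cast hy

/-- The map from the local ring at a point `y` to the residue field at a generalization. -/
noncomputable abbrev toResidue (X : SmoothVariety k) {x y : X.scheme} (h : x ⤳ y) :
    X.scheme.presheaf.stalk y ⟶ X.scheme.residueField x :=
  X.scheme.presheaf.stalkSpecializes h ≫ X.scheme.residue x

/-- The local ring at `x` is the fraction field of the local ring at `y`, and, being a field, agrees
with its residue field. -/
theorem toResidue_structure (X : SmoothVariety k) {x y : X.scheme} (h : x ⤳ y)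
    (hx : coheight x = 0) (hy : coheight y ≤ 1) :
    Function.Injective (X.toResidue h) ∧
      ∀ z, ∃ a b, b ≠ 0 ∧ X.toResidue h b * z = X.toResidue h a := by
  obtain ⟨V, hV, hyV, -⟩ := X.exists_smooth_chart y
  have hxV : x ∈ V := h.mem_open V.2 hyV
  have := (X.isDomain_stalk hy).1
  let := X.scheme.presheaf.algebra_section_stalk ⟨y, hyV⟩
  have := hV.isLocalization_stalk ⟨y, hyV⟩
  let := X.scheme.presheaf.algebra_section_stalk ⟨x, hxV⟩
  have := hV.isLocalization_stalk ⟨x, hxV⟩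
  have hmin : (hV.primeIdealOf ⟨x, hxV⟩).asIdeal ∈ minimalPrimes Γ(X.scheme, V) := by
    rw [← Ideal.height_eq_zero_iff]
    rw [← WithBot.coe_inj, ← IsLocalization.AtPrime.ringKrullDim_eq_height _
      (X.scheme.presheaf.stalk x), ringKrullDim_stalk_eq_coheight, hx]
  obtain ⟨h1, h2, h3⟩ := IsLocalization.AtPrime.field_of_minimal_of_isDomain
    (Sq := X.scheme.presheaf.stalk y) (Sp := X.scheme.presheaf.stalk x)
    (hV.primeIdealOf ⟨x, hxV⟩).asIdeal (hV.primeIdealOf ⟨y, hyV⟩).asIdeal hmin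
    (X.scheme.presheaf.stalkSpecializes h).hom
    (fun r => X.scheme.presheaf.germ_stalkSpecializes_apply hyV h r)
  have hres : Function.Bijective (X.scheme.residue x) :=
    ⟨by
      let := h2.toField
      exact (X.scheme.residue x).hom.injective, X.scheme.residue_surjective x⟩
  refine ⟨hres.1.comp h1, fun z => ?_⟩
  obtain ⟨z, rfl⟩ := hres.2 z
  obtain ⟨a, b, hb, hab⟩ := h3 z
  refine ⟨a, b, hb, ?_⟩
  change X.scheme.residue x (X.scheme.presheaf.stalkSpecializes h b) * X.scheme.residue x z =
    X.scheme.residue x (X.scheme.presheaf.stalkSpecializes h a)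
  rw [← map_mul]
  exact congrArg _ hab

end SmoothVariety

namespace AlgebraicGeometry

/-- The residue field is a quotient of a localization of a finite type algebra. -/
theorem Scheme.essFiniteType_residueField {K : Type u} [Field K] {Y : Scheme.{u}}
    (g : Y ⟶ Spec (CommRingCat.of K)) [LocallyOfFiniteType g] (y : Y) :
    (Spec.preimage (Y.fromSpecResidueField y ≫ g)).hom.EssFiniteType := by
  obtain ⟨_, ⟨V, hV, rfl⟩, hyV, -⟩ :=
    Y.isBasis_affineOpens.exists_subset_of_mem_open (Set.mem_univ y) isOpen_univ
  let φ := Spec.preimage (hV.fromSpec ≫ g)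
  have hφ : φ.hom.FiniteType := by
    rw [← HasRingHomProperty.Spec_iff (P := @LocallyOfFiniteType), Spec.map_preimage]
    have : IsOpenImmersion hV.fromSpec := hV.isOpenImmersion_fromSpec
    infer_instance
  have he : Spec.preimage (Y.fromSpecResidueField y ≫ g) =
      φ ≫ Y.presheaf.germ V y hyV ≫ Y.residue y := by
    apply Spec.map_injective
    rw [Spec.map_preimage, Spec.map_comp, Spec.map_comp, Spec.map_preimage,
      Scheme.fromSpecResidueField, ← hV.fromSpecStalk_eq_fromSpecStalk hyV]
    simp only [Category.assoc, IsAffineOpen.fromSpecStalk]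
  rw [he]
  have hgerm : (Y.presheaf.germ V y hyV).hom.EssFiniteType := by
    let := Y.presheaf.algebra_section_stalk ⟨y, hyV⟩
    have := hV.isLocalization_stalk ⟨y, hyV⟩
    exact RingHom.essFiniteType_algebraMap.2 (Algebra.EssFiniteType.of_isLocalization
      (Y.presheaf.stalk y) (hV.primeIdealOf ⟨y, hyV⟩).asIdeal.primeCompl)
  have hres : (Y.residue y).hom.EssFiniteType :=
    RingHom.FiniteType.essFiniteType (RingHom.FiniteType.of_surjective _ (Y.residue_surjective y))
  simp only [CommRingCat.hom_comp]
  exact RingHom.EssFiniteType.comp hφ.essFiniteType (RingHom.EssFiniteType.comp hgerm hres)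

end AlgebraicGeometry

namespace SmoothVariety

variable {k : Type u} [Field k]

theorem essFiniteType_residueField (X : SmoothVariety k) (x : X.scheme) :
    Algebra.EssFiniteType k (X.scheme.residueField x) :=
  RingHom.essFiniteType_algebraMap.1 (Scheme.essFiniteType_residueField X.str x)

instance finTrdeg_residueField (X : SmoothVariety k) (x : X.scheme) :
    FinTrdeg k (X.scheme.residueField x) :=
  have := X.essFiniteType_residueField x
  inferInstance

theorem specMap_algebraMap_residueField (X : SmoothVariety k) (x : X.scheme) :
    Spec.map (CommRingCat.ofHom (algebraMap k (X.scheme.residueField x))) =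
      X.scheme.fromSpecResidueField x ≫ X.str :=
  Spec.map_preimage _

/-- The `k`-embedding of residue fields induced by a `k`-morphism. -/
noncomputable def residueFieldAlgHom {U X : SmoothVariety k} (f : U.scheme ⟶ X.scheme)
    (hf : f ≫ X.str = U.str) (x : U.scheme) :
    X.scheme.residueField (f x) →ₐ[k] U.scheme.residueField x :=
  { (f.residueFieldMap x).hom with
    commutes' := fun r => by
      have h : CommRingCat.ofHom (algebraMap k (X.scheme.residueField (f x))) ≫
          f.residueFieldMap x = CommRingCat.ofHom (algebraMap k (U.scheme.residueField x)) := by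
        apply Spec.map_injective
        rw [Spec.map_comp, specMap_algebraMap_residueField, specMap_algebraMap_residueField,
          Scheme.Hom.SpecMap_residueFieldMap_fromSpecResidueField_assoc, hf]
      exact congrArg (fun g => g.hom r) h }

variable {F : Type v} [Field F]

/-- The valuation `v` is centered at the point `y`, with respect to an embedding of the residue
field at a generalization `x` of `y`. -/
def IsCentered (X : SmoothVariety k) {x y : X.scheme} (h : x ⤳ y)
    (ι : X.scheme.residueField x →+* F) (v : RatValuation F) : Prop :=
  ∀ b : X.scheme.presheaf.stalk y, v (ι (X.toResidue h b)) ≤ 1 ∧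
    (b ∈ IsLocalRing.maximalIdeal (X.scheme.presheaf.stalk y) → v (ι (X.toResidue h b)) < 1)

/-- The local rings in codimension at most one are maximal with respect to domination. -/
theorem IsCentered.le_one_iff {X : SmoothVariety k} {x y : X.scheme} {h : x ⤳ y}
    {ι : X.scheme.residueField x →+* F} {v : RatValuation F} (hc : X.IsCentered h ι v)
    (hx : coheight x = 0) (hy : coheight y ≤ 1) (z : X.scheme.residueField x) :
    v (ι z) ≤ 1 ↔ ∃ b, X.toResidue h b = z := by
  constructor
  · intro hz
    obtain ⟨hinj, hfrac⟩ := X.toResidue_structure h hx hy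
    obtain ⟨hdom, hdvd⟩ := X.isDomain_stalk hy
    obtain ⟨a, b, hb, hab⟩ := hfrac z
    have hb' : X.toResidue h b ≠ 0 := fun h0 => hb (hinj (by rw [h0, map_zero]))
    -- Write `z = a / b`. Either `b ∣ a`, or `1 / z` comes from some `c` in the local ring; a
    -- non-unit `c` would have valuation less than one, contradicting `v(z) ≤ 1`.
    rcases hdvd b a with ⟨c, rfl⟩ | ⟨c, rfl⟩
    · refine ⟨c, ?_⟩
      rw [map_mul] at hab
      exact (mul_left_cancel₀ hb' hab).symm
    · have ha' : X.toResidue h a ≠ 0 := fun h0 => hb' (by rw [map_mul, h0, zero_mul])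
      have hcz : X.toResidue h c * z = 1 := by
        rw [map_mul, mul_assoc] at hab
        exact mul_left_cancel₀ ha' (hab.trans (mul_one _).symm)
      by_cases hcu : IsUnit c
      · obtain ⟨d, hd⟩ := hcu.exists_left_inv
        refine ⟨d, ?_⟩
        calc X.toResidue h d = X.toResidue h d * (X.toResidue h c * z) := by rw [hcz, mul_one]
          _ = X.toResidue h (d * c) * z := by rw [map_mul, mul_assoc]
          _ = z := by rw [hd, map_one, one_mul]
      · have h1 := (hc c).2 hcu
        have h2 : v (ι (X.toResidue h c)) * v (ι z) = 1 := by
          rw [← map_mul, ← map_mul, hcz, map_one, map_one]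
        exact absurd h2 (mul_lt_one_of_lt_of_le h1 hz).ne
  · rintro ⟨b, rfl⟩
    exact (hc b).1

/-- Centres push forward because stalk maps are local homomorphisms. -/
theorem IsCentered.comp_residueFieldMap {U X : SmoothVariety k} (f : U.scheme ⟶ X.scheme)
    {x y : U.scheme} {h : x ⤳ y} {ι : U.scheme.residueField x →+* F} {v : RatValuation F}
    (hc : U.IsCentered h ι v) :
    X.IsCentered (h.map f.continuous) (ι.comp (f.residueFieldMap x).hom) v := by
  have key : X.toResidue (h.map f.continuous) ≫ f.residueFieldMap x =
      f.stalkMap y ≫ U.toResidue h := by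
    rw [toResidue, Category.assoc, Scheme.residue_residueFieldMap, toResidue,
      ← Category.assoc, ← Category.assoc, Scheme.Hom.stalkSpecializes_stalkMap]
  intro b
  have hb : f.residueFieldMap x (X.toResidue (h.map f.continuous) b) =
      U.toResidue h (f.stalkMap y b) := congrArg (fun g => g.hom b) key
  change v (ι (f.residueFieldMap x (X.toResidue (h.map f.continuous) b))) ≤ 1 ∧
    (_ → v (ι (f.residueFieldMap x (X.toResidue (h.map f.continuous) b))) < 1)
  rw [hb]
  refine ⟨(hc _).1, fun hm => (hc _).2 ?_⟩
  intro hu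
  exact hm (isUnit_of_map_unit (f.stalkMap y).hom b hu)

theorem toResidue_refl (X : SmoothVariety k) (x : X.scheme) (h : x ⤳ x) :
    X.toResidue h = X.scheme.residue x := by
  rw [toResidue, TopCat.Presheaf.stalkSpecializes_refl, Category.id_comp]

variable [Algebra k F]

/-- A trivial restriction is the case of a centre at the generic point, a divisorial one that of a
centre in codimension one. The converse uses that these local rings are maximal for domination. The
description by centres is the one that is functorial. -/
theorem mem_divisorialValuations_iff (X : SmoothVariety k) {x : X.scheme} (hx : coheight x = 0)
    (ι : X.scheme.residueField x →ₐ[k] F) (v : RatValuation F) :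
    v ∈ divisorialValuations X x ι ↔ IsDiscreteRankOne k v ∧
      ∃ (y : X.scheme) (h : x ⤳ y), coheight y ≤ 1 ∧ X.IsCentered h (ι : _ →+* F) v := by
  have hzero : ∀ z, z = 0 → v (ι z) = 0 := by
    rintro _ rfl
    rw [map_zero, map_zero]
  refine and_congr_right fun hv => ⟨?_, ?_⟩
  · rintro (htriv | ⟨y, h, hy, hval⟩)
    · refine ⟨x, specializes_rfl, hx.trans_le zero_le, fun b => ⟨?_, fun hb => ?_⟩⟩
      · rcases eq_or_ne (X.toResidue specializes_rfl b) 0 with h0 | h0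
        · exact (hzero _ h0).trans_le zero_le_one
        · exact (htriv _ h0).le
      · have h0 : X.toResidue specializes_rfl b = 0 := by
          rw [toResidue_refl]
          exact (IsLocalRing.residue_eq_zero_iff b).2 hb
        exact (hzero _ h0).trans_lt one_pos
    · refine ⟨y, h, hy.le, fun b => ⟨(hval _).2 ⟨b, rfl⟩, fun hb => ?_⟩⟩
      refine lt_of_le_of_ne ((hval _).2 ⟨b, rfl⟩) fun h1 => ?_
      obtain ⟨hinj, -⟩ := X.toResidue_structure h hx hy.le
      have hb0 : X.toResidue h b ≠ 0 := fun h0 => zero_ne_one ((hzero _ h0).symm.trans h1)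
      obtain ⟨c, hc⟩ := (hval (X.toResidue h b)⁻¹).1 (by
        rw [map_inv₀, map_inv₀]
        exact (inv_eq_one.2 h1).le)
      have h2 : b * c = 1 := hinj (by
        rw [map_mul, map_one]
        exact (congrArg _ hc).trans (mul_inv_cancel₀ hb0))
      exact (IsLocalRing.mem_maximalIdeal b).1 hb (IsUnit.of_mul_eq_one _ h2)
  · rintro ⟨y, h, hy, hc⟩
    have hval := hc.le_one_iff hx hy
    rcases Order.le_one_iff.1 hy with hy0 | hy1
    · obtain rfl : x = y := Scheme.eq_of_specializes hy0 h
      left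
      have hle : ∀ a, v (ι a) ≤ 1 := fun a => (hval a).2 (by
        rw [toResidue_refl]
        exact X.scheme.residue_surjective x a)
      intro a ha
      refine le_antisymm (hle a) ?_
      have h1 := hle a⁻¹
      rw [map_inv₀, map_inv₀] at h1
      have h2 : v (ι a) ≠ 0 := by simpa using ha
      exact (inv_le_one₀ (zero_lt_iff.2 h2)).1 h1
    · exact Or.inr ⟨y, h, hy1, hval⟩

end SmoothVariety

/-! ### The presheaf `𝒲` -/

namespace SmoothVariety

variable {k : Type u} [Field k] {F : Type v} [Field F] [Algebra k F]
  {W : Type w} [AddCommGroup W] [Module ℚ W]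

theorem apply_eq_apply_of_mem_fixedVectors {ρ : Representation ℚ (F ≃ₐ[k] F) W} {S : Set F} {w : W}
    (hw : w ∈ fixedVectors ρ S) {σ τ : F ≃ₐ[k] F} (h : ∀ a ∈ S, σ a = τ a) : ρ σ w = ρ τ w := by
  have h1 := mem_fixedVectors_iff.1 hw (τ⁻¹ * σ) fun a ha => by
    change τ.symm (σ a) = a
    rw [h a ha, AlgEquiv.symm_apply_apply]
  have h2 : σ = τ * (τ⁻¹ * σ) := by group
  rw [h2, map_mul, Module.End.mul_apply, h1]

theorem exists_extends [IsAlgClosed F] (hF : Algebra.trdeg k F = Cardinal.aleph0)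
    (ι : EmbeddingChoice k F) {U X : SmoothVariety k} (f : U ⟶ X) (x : GenericPoint U) :
    ∃ τ : F ≃ₐ[k] F, Extends ι f x τ :=
  exists_algEquiv_extending hF (ι X (Hom.onGeneric f x))
    ((ι U x).comp (residueFieldAlgHom f.hom f.w x.1))

/-- If `v` is centred at `y`, then `v ∘ τ` is centred at `f(y)`, whose codimension is at most one by
the definition of morphisms in the site. -/
theorem apply_mem_componentSections {ρ : Representation ℚ (F ≃ₐ[k] F) W}
    {ι : EmbeddingChoice k F} {U X : SmoothVariety k} {f : U ⟶ X} {x : GenericPoint U}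
    {τ : F ≃ₐ[k] F} (hτ : Extends ι f x τ) {w : W}
    (hw : w ∈ componentSections ρ ι X (Hom.onGeneric f x)) :
    ρ τ w ∈ componentSections ρ ι U x := by
  refine ⟨map_mem_fixedVectors hw.1 τ ?_, ?_⟩
  · rintro _ ⟨a, rfl⟩
    exact ⟨_, (hτ a).symm⟩
  · refine (Submodule.mem_iInf _).2 fun v => (Submodule.mem_iInf _).2 fun hv => ?_
    rw [← mem_localPart_comp_iff]
    refine (Submodule.mem_iInf _).1 ((Submodule.mem_iInf _).1 hw.2 _) ?_
    rw [mem_divisorialValuations_iff _ x.2] at hv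
    refine (X.mem_divisorialValuations_iff (Hom.onGeneric f x).2 _ _).2 ?_
    obtain ⟨hv1, y, h, hy, hc⟩ := hv
    refine ⟨hv1.comp τ, f.hom y, h.map f.hom.continuous, ?_, ?_⟩
    · rcases Order.le_one_iff.1 hy with hy | hy
      · exact (f.dominant y hy).trans_le zero_le
      · exact Order.le_one_iff.2 (f.divisor y hy)
    · intro b
      have h1 := hc.comp_residueFieldMap (X := X) f.hom b
      have h2 := hτ (X.toResidue (h.map f.hom.continuous) b)
      exact ⟨(congrArg v h2).trans_le h1.1, fun hb => (congrArg v h2).trans_lt (h1.2 hb)⟩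

theorem Extends.id (ι : EmbeddingChoice k F) (U : SmoothVariety k) (x : GenericPoint U) :
    Extends ι (𝟙 U) x 1 := by
  intro a
  have h : (𝟙 U : U ⟶ U).hom.residueFieldMap x.1 = 𝟙 (U.scheme.residueField x.1) :=
    Scheme.residueFieldMap_id x.1
  rw [h]
  rfl

theorem Extends.comp {ι : EmbeddingChoice k F} {U X Y : SmoothVariety k} {f : U ⟶ X} {g : X ⟶ Y}
    {x : GenericPoint U} {σ τ : F ≃ₐ[k] F} (hσ : Extends ι f x σ)
    (hτ : Extends ι g (Hom.onGeneric f x) τ) : Extends ι (f ≫ g) x (σ * τ) := by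
  intro a
  have h : (f ≫ g).hom.residueFieldMap x.1 =
      g.hom.residueFieldMap (f.hom x.1) ≫ f.hom.residueFieldMap x.1 :=
    Scheme.residueFieldMap_comp f.hom g.hom x.1
  rw [h]
  exact (congrArg σ (hτ a)).trans (hσ _)

section

variable [IsAlgClosed F] (hF : Algebra.trdeg k F = Cardinal.aleph0)
  (ρ : Representation ℚ (F ≃ₐ[k] F) W) (ι : EmbeddingChoice k F)

/-- The restriction map of sections along a morphism of the Hartogs site. -/
noncomputable def restriction {U X : SmoothVariety k} (f : U ⟶ X) :
    Sections ρ ι X →ₗ[ℚ] Sections ρ ι U where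
  toFun s x := ⟨ρ (exists_extends hF ι f x).choose (s (Hom.onGeneric f x)),
    apply_mem_componentSections (exists_extends hF ι f x).choose_spec (s _).2⟩
  map_add' s t := by
    ext x
    exact map_add (ρ _) _ _
  map_smul' c s := by
    ext x
    exact map_smul (ρ _) _ _

theorem restriction_apply {U X : SmoothVariety k} (f : U ⟶ X) (s : Sections ρ ι X)
    (x : GenericPoint U) (τ : F ≃ₐ[k] F) (hτ : Extends ι f x τ) :
    (restriction hF ρ ι f s x : W) = ρ τ (s (Hom.onGeneric f x)) := by
  refine apply_eq_apply_of_mem_fixedVectors (s (Hom.onGeneric f x)).2.1 ?_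
  rintro _ ⟨a, rfl⟩
  rw [hτ a]
  exact (exists_extends hF ι f x).choose_spec a

/-- The presheaf `𝒲` on the Hartogs site. -/
noncomputable def sectionsPresheaf : (SmoothVariety k)ᵒᵖ ⥤ ModuleCat.{max u w} ℚ where
  obj X := ModuleCat.of ℚ (Sections ρ ι X.unop)
  map f := ModuleCat.ofHom (restriction hF ρ ι f.unop)
  map_id X := by
    ext s x
    refine (restriction_apply hF ρ ι (𝟙 X.unop) s x 1 (Extends.id ι _ x)).trans ?_
    rw [map_one]
    rfl
  map_comp {X Y Z} f g := by
    ext s x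
    obtain ⟨σ, hσ⟩ := exists_extends hF ι g.unop x
    obtain ⟨τ, hτ⟩ := exists_extends hF ι f.unop (Hom.onGeneric g.unop x)
    refine (restriction_apply hF ρ ι (g.unop ≫ f.unop) s x _ (hσ.comp hτ)).trans ?_
    rw [map_mul]
    refine Eq.symm ((restriction_apply hF ρ ι g.unop _ x σ hσ).trans ?_)
    exact congrArg (ρ σ) (restriction_apply hF ρ ι f.unop s _ τ hτ)

end

end SmoothVariety

/-! ### Sections as equivariant functions on generic geometric points -/

namespace SmoothVariety

variable {k : Type u} [Field k] {F : Type v} [Field F] [Algebra k F]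
  {W : Type w} [AddCommGroup W] [Module ℚ W]
  {Ω : Type u} [Field Ω] [Algebra k Ω] (e : F ≃ₐ[k] Ω)

/-- The geometric point of `X` given by an embedding of the residue field at `x` into `F`, where
`Ω` is a copy of `F` in the universe of `X`. -/
noncomputable def geomPoint (X : SmoothVariety k) (x : X.scheme) (a : X.scheme.residueField x →ₐ[k] F) :
    Spec (CommRingCat.of Ω) ⟶ X.scheme :=
  Spec.map (CommRingCat.ofHom ((e : F →ₐ[k] Ω).comp a).toRingHom) ≫ X.scheme.fromSpecResidueField x

theorem geomPoint_str (X : SmoothVariety k) (x : X.scheme) (a : X.scheme.residueField x →ₐ[k] F) :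
    X.geomPoint e x a ≫ X.str = Spec.map (CommRingCat.ofHom (algebraMap k Ω)) := by
  rw [geomPoint, Category.assoc, ← specMap_algebraMap_residueField, ← Spec.map_comp,
    ← CommRingCat.ofHom_comp]
  congr 2
  exact ((e : F →ₐ[k] Ω).comp a).comp_algebraMap

theorem geomPoint_apply (X : SmoothVariety k) (x : X.scheme) (a : X.scheme.residueField x →ₐ[k] F)
    (z : Spec (CommRingCat.of Ω)) : X.geomPoint e x a z = x := by
  rw [geomPoint, Scheme.Hom.comp_apply, Scheme.fromSpecResidueField_apply]

theorem geomPoint_comp {U X : SmoothVariety k} (f : U.scheme ⟶ X.scheme) (hf : f ≫ X.str = U.str)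
    (u : U.scheme) (b : U.scheme.residueField u →ₐ[k] F) :
    U.geomPoint e u b ≫ f = X.geomPoint e (f u) (b.comp (residueFieldAlgHom f hf u)) := by
  rw [geomPoint, Category.assoc, ← Scheme.Hom.SpecMap_residueFieldMap_fromSpecResidueField,
    ← Category.assoc, ← Spec.map_comp]
  rfl

theorem eq_geomPoint (X : SmoothVariety k) (φ : Spec (CommRingCat.of Ω) ⟶ X.scheme)
    (hφ : φ ≫ X.str = Spec.map (CommRingCat.ofHom (algebraMap k Ω)))
    (z : Spec (CommRingCat.of Ω)) : ∃ a, φ = X.geomPoint e (φ z) a := by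
  obtain ⟨⟨x, c⟩, rfl⟩ := (Scheme.SpecToEquivOfField Ω X.scheme).symm.surjective φ
  have hx : (Scheme.SpecToEquivOfField Ω X.scheme).symm ⟨x, c⟩ =
    Spec.map c ≫ X.scheme.fromSpecResidueField x := rfl
  rw [hx] at hφ ⊢
  have hpt : (Spec.map c ≫ X.scheme.fromSpecResidueField x) z = x := by
    rw [Scheme.Hom.comp_apply, Scheme.fromSpecResidueField_apply]
  rw [hpt]
  let c' : X.scheme.residueField x →ₐ[k] Ω :=
    { c.hom with
      commutes' := fun r => by
        rw [Category.assoc, ← specMap_algebraMap_residueField, ← Spec.map_comp] at hφ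
        exact congrArg (fun g => g.hom r) (Spec.map_injective hφ) }
  refine ⟨(e.symm : Ω →ₐ[k] F).comp c', ?_⟩
  rw [geomPoint]
  congr 2
  ext z
  exact (e.apply_symm_apply (c z)).symm

/-- Two geometric points coincide if and only if they have the same image and the embeddings
agree. -/
theorem geomPoint_injective (X : SmoothVariety k) {x y : X.scheme}
    {a : X.scheme.residueField x →ₐ[k] F} {b : X.scheme.residueField y →ₐ[k] F}
    (h : X.geomPoint e x a = X.geomPoint e y b) : x = y ∧ HEq a b := by
  have hxy : x = y := by
    have z : Spec (CommRingCat.of Ω) := Classical.choice inferInstance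
    rw [← X.geomPoint_apply e x a z, h, X.geomPoint_apply]
  subst hxy
  refine ⟨rfl, heq_of_eq ?_⟩
  have h1 : (⟨x, CommRingCat.ofHom ((e : F →ₐ[k] Ω).comp a).toRingHom⟩ :
      Σ x, X.scheme.residueField x ⟶ .of Ω) =
      ⟨x, CommRingCat.ofHom ((e : F →ₐ[k] Ω).comp b).toRingHom⟩ :=
    (Scheme.SpecToEquivOfField Ω X.scheme).symm.injective h
  have h2 := eq_of_heq (Sigma.mk.inj h1).2
  ext z
  exact e.injective (congrArg (fun g => g.hom z) h2)

theorem exists_embedding_extends [IsAlgClosed F] (hF : Algebra.trdeg k F = Cardinal.aleph0)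
    (ι : EmbeddingChoice k F) (X : SmoothVariety k) (x : GenericPoint X)
    (a : X.scheme.residueField x.1 →ₐ[k] F) : ∃ τ : F ≃ₐ[k] F, ∀ z, τ (ι X x z) = a z :=
  exists_algEquiv_extending hF (ι X x) a

variable [IsAlgClosed F] (hF : Algebra.trdeg k F = Cardinal.aleph0)
  {ρ : Representation ℚ (F ≃ₐ[k] F) W} {ι : EmbeddingChoice k F}

/-- The transport of a section along an embedding of the function field at a generic point. -/
noncomputable def evalAt {X : SmoothVariety k} (s : Sections ρ ι X) (x : GenericPoint X)
    (a : X.scheme.residueField x.1 →ₐ[k] F) : W :=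
  ρ (exists_embedding_extends hF ι X x a).choose (s x)

theorem evalAt_eq {X : SmoothVariety k} (s : Sections ρ ι X) (x : GenericPoint X)
    (a : X.scheme.residueField x.1 →ₐ[k] F) (τ : F ≃ₐ[k] F) (hτ : ∀ z, τ (ι X x z) = a z) :
    evalAt hF s x a = ρ τ (s x) := by
  refine apply_eq_apply_of_mem_fixedVectors (s x).2.1 ?_
  rintro _ ⟨z, rfl⟩
  rw [hτ z]
  exact (exists_embedding_extends hF ι X x a).choose_spec z

theorem evalAt_self {X : SmoothVariety k} (s : Sections ρ ι X) (x : GenericPoint X) :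
    evalAt hF s x (ι X x) = s x := by
  rw [evalAt_eq hF s x _ 1 fun _ => rfl, map_one]
  rfl

theorem evalAt_smul {X : SmoothVariety k} (s : Sections ρ ι X) (x : GenericPoint X)
    (a : X.scheme.residueField x.1 →ₐ[k] F) (σ : F ≃ₐ[k] F) :
    ρ σ (evalAt hF s x a) = evalAt hF s x ((σ : F →ₐ[k] F).comp a) := by
  obtain ⟨τ, hτ⟩ := exists_embedding_extends hF ι X x a
  have h : evalAt hF s x ((σ : F →ₐ[k] F).comp a) = ρ (σ * τ) (s x) :=
    evalAt_eq hF s x _ _ fun z => congrArg σ (hτ z)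
  rw [evalAt_eq hF s x a τ hτ, h, map_mul]
  rfl

/-- Equality of geometric points, as morphisms of schemes, stands in for equality of embeddings with
varying domain. -/
theorem evalAt_congr {X : SmoothVariety k} (s : Sections ρ ι X) {x y : GenericPoint X}
    {a : X.scheme.residueField x.1 →ₐ[k] F} {b : X.scheme.residueField y.1 →ₐ[k] F}
    (h : X.geomPoint e x a = X.geomPoint e y b) : evalAt hF s x a = evalAt hF s y b := by
  obtain ⟨x, hx⟩ := x
  obtain ⟨y, hy⟩ := y
  obtain ⟨rfl : x = y, hab⟩ := X.geomPoint_injective e h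
  rw [eq_of_heq hab]

theorem evalAt_restriction {U X : SmoothVariety k} (f : U ⟶ X) (t : Sections ρ ι X)
    (u : GenericPoint U) (b : U.scheme.residueField u.1 →ₐ[k] F) :
    evalAt hF (restriction hF ρ ι f t) u b =
      evalAt hF t (Hom.onGeneric f u) (b.comp (residueFieldAlgHom f.hom f.w u.1)) := by
  obtain ⟨τ, hτ⟩ := exists_embedding_extends hF ι U u b
  obtain ⟨σ, hσ⟩ := exists_extends hF ι f u
  rw [evalAt_eq hF _ u b τ hτ, restriction_apply hF ρ ι f t u σ hσ,
    evalAt_eq hF t _ _ (τ * σ) fun z => ?_, map_mul]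
  · rfl
  · exact (congrArg τ (hσ z)).trans (hτ _)

/-- A section with equal restrictions along `p` and `q` has the same values at the two images of a
generic geometric point. -/
theorem evalAt_eq_of_restriction_eq {R U : SmoothVariety k} (p q : R ⟶ U) (s : Sections ρ ι U)
    (h : restriction hF ρ ι p s = restriction hF ρ ι q s)
    (φ : Spec (CommRingCat.of Ω) ⟶ R.scheme)
    (hφ : φ ≫ R.str = Spec.map (CommRingCat.ofHom (algebraMap k Ω)))
    (z : Spec (CommRingCat.of Ω)) (hgen : coheight (φ z) = 0) {u₁ u₂ : GenericPoint U}
    {b₁ : U.scheme.residueField u₁.1 →ₐ[k] F} {b₂ : U.scheme.residueField u₂.1 →ₐ[k] F}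
    (h₁ : U.geomPoint e u₁ b₁ = φ ≫ p.hom) (h₂ : U.geomPoint e u₂ b₂ = φ ≫ q.hom) :
    evalAt hF s u₁ b₁ = evalAt hF s u₂ b₂ := by
  obtain ⟨c, hc⟩ := R.eq_geomPoint e φ hφ z
  let w : GenericPoint R := ⟨_, hgen⟩
  have hp : evalAt hF s u₁ b₁ = evalAt hF (restriction hF ρ ι p s) w c := by
    rw [evalAt_restriction]
    refine evalAt_congr e hF s ?_
    rw [h₁, hc]
    exact geomPoint_comp e p.hom p.w _ c
  have hq : evalAt hF s u₂ b₂ = evalAt hF (restriction hF ρ ι q s) w c := by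
    rw [evalAt_restriction]
    refine evalAt_congr e hF s ?_
    rw [h₂, hc]
    exact geomPoint_comp e q.hom q.w _ c
  rw [hp, hq, h]

end SmoothVariety

/-! ### Independence of the chosen lift of a geometric point -/

namespace AlgebraicGeometry

/-- This map is the base change of `g` along the first projection of `U ×_X U`. -/
theorem Flat.lift_pullback {S U X : Scheme.{u}} (g : S ⟶ U) (f : U ⟶ X) (h : S ⟶ X)
    (hg : g ≫ f = h) [Flat g] :
    Flat (pullback.lift (pullback.fst h f ≫ g) (pullback.snd h f)
      (by rw [Category.assoc, hg, pullback.condition]) : pullback h f ⟶ pullback f f) := by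
  subst hg
  have h1 : IsPullback (pullback.lift (f := f) (g := f) (pullback.fst (g ≫ f) f ≫ g)
      (pullback.snd (g ≫ f) f) (by rw [Category.assoc, pullback.condition]) ≫ pullback.snd f f)
      (pullback.fst (g ≫ f) f) f (g ≫ f) := by
    rw [pullback.lift_snd]
    exact (IsPullback.of_hasPullback (g ≫ f) f).flip
  have h2 := IsPullback.of_right h1 (pullback.lift_fst _ _ _) (IsPullback.of_hasPullback f f).flip
  exact MorphismProperty.of_isPullback (P := @Flat) h2.flip inferInstance

/-- The residue field at a generic point of `P` is finitely generated over `K`, and `Ω` still has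
infinite transcendence degree over `K`. -/
theorem Scheme.exists_generic_geomPoint {k K Ω : Type u} [Field k] [Field K] [Field Ω] [Algebra k K]
    [Algebra k Ω] [Algebra K Ω] [IsScalarTower k K Ω] [FinTrdeg k K] [IsAlgClosed Ω]
    (hΩ : Cardinal.aleph0 ≤ Algebra.trdeg k Ω) {P : Scheme.{u}} [Nonempty P]
    (q : P ⟶ Spec (CommRingCat.of K)) [LocallyOfFiniteType q] :
    ∃ φ : Spec (CommRingCat.of Ω) ⟶ P, (∀ z, coheight (φ z) = 0) ∧
      φ ≫ q = Spec.map (CommRingCat.ofHom (algebraMap K Ω)) := by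
  have : IsLocallyNoetherian P := LocallyOfFiniteType.isLocallyNoetherian q
  obtain ⟨ξ, -, hξ⟩ := Scheme.exists_specializes_coheight_eq_zero (Classical.arbitrary P)
  let : Algebra K (P.residueField ξ) :=
    (Spec.preimage (P.fromSpecResidueField ξ ≫ q)).hom.toAlgebra
  have : Algebra.EssFiniteType K (P.residueField ξ) :=
    RingHom.essFiniteType_algebraMap.1 (Scheme.essFiniteType_residueField q ξ)
  obtain ⟨c⟩ := FinTrdeg.nonempty_algHom K (P.residueField ξ) Ω
    (aleph0_le_trdeg_of_finTrdeg k K Ω hΩ)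
  refine ⟨Spec.map (CommRingCat.ofHom c.toRingHom) ≫ P.fromSpecResidueField ξ, fun z => ?_, ?_⟩
  · rw [Scheme.Hom.comp_apply, Scheme.fromSpecResidueField_apply, hξ]
  · rw [Category.assoc, ← Spec.map_preimage (P.fromSpecResidueField ξ ≫ q), ← Spec.map_comp]
    congr 1
    ext z
    exact c.commutes z

end AlgebraicGeometry

namespace SmoothVariety

variable {k : Type u} [Field k]

theorem isField_stalk (X : SmoothVariety k) {x : X.scheme} (hx : coheight x = 0) :
    IsField (X.scheme.presheaf.stalk x) := by
  have hinj : Function.Injective (X.scheme.residue x) := by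
    have h := (X.toResidue_structure specializes_rfl hx (hx.trans_le zero_le)).1
    rwa [toResidue_refl] at h
  have he : Function.Bijective (X.scheme.residue x).hom := ⟨hinj, X.scheme.residue_surjective x⟩
  exact (RingEquiv.ofBijective _ he).toMulEquiv.isField (Field.toIsField _)

theorem flat_fromSpecResidueField (X : SmoothVariety k) {x : X.scheme} (hx : coheight x = 0) :
    Flat (X.scheme.fromSpecResidueField x) := by
  refine Flat.of_stalkMap _ fun z => ?_
  have hz : coheight (X.scheme.fromSpecResidueField x z) = 0 := by
    rw [Scheme.fromSpecResidueField_apply, hx]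
  exact RingHom.Flat.of_isField (X.isField_stalk hz) _

variable {F : Type v} [Field F] [Algebra k F] {W : Type w} [AddCommGroup W] [Module ℚ W]
  {Ω : Type u} [Field Ω] [Algebra k Ω]

theorem finTrdeg_fieldRange_sup {U X : SmoothVariety k} {u : U.scheme}
    {x : X.scheme} (a : U.scheme.residueField u →ₐ[k] Ω) (b : X.scheme.residueField x →ₐ[k] Ω) :
    FinTrdeg k (a.fieldRange ⊔ b.fieldRange : IntermediateField k Ω) := by
  have h (Y : SmoothVariety k) (y : Y.scheme) (c : Y.scheme.residueField y →ₐ[k] Ω) :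
      c.fieldRange.FG := by
    rw [← IntermediateField.essFiniteType_iff]
    have := Y.essFiniteType_residueField y
    exact Algebra.EssFiniteType.of_surjective (AlgHom.rangeRestrict c) c.rangeRestrict_surjective
  have := IntermediateField.essFiniteType_iff.2 (IntermediateField.fg_sup (h U u a) (h X x b))
  infer_instance

variable [IsAlgClosed F] [IsAlgClosed Ω] (hF : Algebra.trdeg k F = Cardinal.aleph0)
  {ρ : Representation ℚ (F ≃ₐ[k] F) W} {ι : EmbeddingChoice k F}

/-- If the two restrictions of a section to `U ×_X U` agree, then its value at a generic geometric
point of `U` depends only on the image of the point in `X`. -/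
theorem evalAt_eq_of_comp_eq (e : F ≃ₐ[k] Ω) {U X : SmoothVariety k} (f : U ⟶ X)
    (hf : Smooth f.hom) (s : Sections ρ ι U)
    (hs : restriction hF ρ ι (fibreSquareFst f hf) s = restriction hF ρ ι (fibreSquareSnd f hf) s)
    {u₁ u₂ : GenericPoint U} {b₁ : U.scheme.residueField u₁.1 →ₐ[k] F}
    {b₂ : U.scheme.residueField u₂.1 →ₐ[k] F}
    (h : U.geomPoint e u₁ b₁ ≫ f.hom = U.geomPoint e u₂ b₂ ≫ f.hom) :
    evalAt hF s u₁ b₁ = evalAt hF s u₂ b₂ := by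
  have hΩ : Cardinal.aleph0 ≤ Algebra.trdeg k Ω := by
    have := e.lift_trdeg_eq
    rw [hF, Cardinal.lift_aleph0] at this
    exact (Cardinal.lift_eq_aleph0.1 this.symm).ge
  let c₁ := (e : F →ₐ[k] Ω).comp b₁
  let c₂ := (e : F →ₐ[k] Ω).comp b₂
  -- Both geometric points are defined over the compositum `K`; the auxiliary third point is chosen
  -- generic over it.
  let K : IntermediateField k Ω := c₁.fieldRange ⊔ c₂.fieldRange
  have : FinTrdeg k K := finTrdeg_fieldRange_sup c₁ c₂
  let i : Spec (CommRingCat.of Ω) ⟶ Spec (CommRingCat.of K) :=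
    Spec.map (CommRingCat.ofHom (algebraMap K Ω))
  have : Surjective i := ⟨fun y => ⟨Classical.choice inferInstance, Subsingleton.elim _ _⟩⟩
  -- This descends the equality of the images in `X` from `Ω` to `K`.
  have hi : Epi i := Flat.epi_of_flat_of_surjective i
  have factor (u : GenericPoint U) (b : U.scheme.residueField u.1 →ₐ[k] F)
      (hb : ((e : F →ₐ[k] Ω).comp b).fieldRange ≤ K) :
      ∃ g : Spec (CommRingCat.of K) ⟶ U.scheme, Flat g ∧ U.geomPoint e u b = i ≫ g := by
    let d : U.scheme.residueField u.1 →ₐ[k] K :=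
      (IntermediateField.inclusion hb).comp ((e : F →ₐ[k] Ω).comp b).rangeRestrict
    have := U.flat_fromSpecResidueField u.2
    refine ⟨Spec.map (CommRingCat.ofHom d.toRingHom) ≫ U.scheme.fromSpecResidueField u.1,
      inferInstance, ?_⟩
    rw [← Category.assoc, ← Spec.map_comp]
    rfl
  obtain ⟨g₁, hg₁, h₁⟩ := factor u₁ b₁ le_sup_left
  obtain ⟨g₂, hg₂, h₂⟩ := factor u₂ b₂ le_sup_right
  have hg : g₂ ≫ f.hom = g₁ ≫ f.hom := by
    rw [← cancel_epi i, ← Category.assoc, ← h₂, ← h, h₁, Category.assoc]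
  have hne : Nonempty (pullback (g₁ ≫ f.hom) f.hom : Scheme.{u}) := by
    let z : Spec (CommRingCat.of K) := Classical.choice inferInstance
    exact ⟨pullback.lift (𝟙 _) g₁ (by rw [Category.id_comp]) z⟩
  obtain ⟨φ, hφ, hφi⟩ := Scheme.exists_generic_geomPoint hΩ (pullback.fst (g₁ ≫ f.hom) f.hom)
  let z : Spec (CommRingCat.of Ω) := Classical.choice inferInstance
  -- The pair formed by either given point and the auxiliary one is generic in `U ×_X U`: it is the
  -- image of a generic point of `Spec K ×_X U` under a flat map.
  have key (g : Spec (CommRingCat.of K) ⟶ U.scheme) (hgf : g ≫ f.hom = g₁ ≫ f.hom) (hfl : Flat g)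
      (u : GenericPoint U) (b : U.scheme.residueField u.1 →ₐ[k] F)
      (hu : U.geomPoint e u b = i ≫ g) :
      ∃ χ : Spec (CommRingCat.of Ω) ⟶ (fibreSquare f hf).scheme, coheight (χ z) = 0 ∧
        χ ≫ (fibreSquareFst f hf).hom = U.geomPoint e u b ∧
        χ ≫ (fibreSquareSnd f hf).hom = φ ≫ pullback.snd _ _ := by
    obtain ⟨l, hl, hl₁, hl₂⟩ : ∃ l : pullback (g₁ ≫ f.hom) f.hom ⟶ pullback f.hom f.hom, Flat l ∧
        l ≫ pullback.fst _ _ = pullback.fst _ _ ≫ g ∧ l ≫ pullback.snd _ _ = pullback.snd _ _ :=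
      ⟨_, Flat.lift_pullback g f.hom _ hgf, pullback.lift_fst _ _ _, pullback.lift_snd _ _ _⟩
    refine ⟨φ ≫ l, le_antisymm ((coheight_le_of_generalizingMap l (Flat.generalizingMap l)
      (φ z)).trans (hφ z).le) zero_le, ?_, ?_⟩
    · refine (Category.assoc φ l (pullback.fst f.hom f.hom)).trans ?_
      rw [hl₁, ← Category.assoc, hφi, hu]
    · refine (Category.assoc φ l (pullback.snd f.hom f.hom)).trans ?_
      rw [hl₂]
  obtain ⟨χ₁, hχ₁, hχ₁u, hχ₁ψ⟩ := key g₁ rfl hg₁ u₁ b₁ h₁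
  obtain ⟨χ₂, hχ₂, hχ₂u, hχ₂ψ⟩ := key g₂ hg hg₂ u₂ b₂ h₂
  have hstr (χ : Spec (CommRingCat.of Ω) ⟶ (fibreSquare f hf).scheme) (u : GenericPoint U)
      (b : U.scheme.residueField u.1 →ₐ[k] F)
      (hχ : χ ≫ (fibreSquareFst f hf).hom = U.geomPoint e u b) :
      χ ≫ (fibreSquare f hf).str = Spec.map (CommRingCat.ofHom (algebraMap k Ω)) := by
    rw [← (fibreSquareFst f hf).w, ← Category.assoc, hχ, geomPoint_str]
  have hψ : (φ ≫ pullback.snd _ _) ≫ U.str =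
      Spec.map (CommRingCat.ofHom (algebraMap k Ω)) := by
    rw [← hχ₁ψ, Category.assoc, (fibreSquareSnd f hf).w, hstr χ₁ u₁ b₁ hχ₁u]
  have hψ0 : coheight ((φ ≫ pullback.snd (g₁ ≫ f.hom) f.hom) z) = 0 := by
    rw [← hχ₁ψ, Scheme.Hom.comp_apply]
    exact (fibreSquareSnd f hf).dominant _ hχ₁
  obtain ⟨b, hb⟩ := U.eq_geomPoint e _ hψ z
  let u : GenericPoint U := ⟨_, hψ0⟩
  rw [evalAt_eq_of_restriction_eq e hF _ _ s hs χ₁ (hstr χ₁ u₁ b₁ hχ₁u) z hχ₁ (u₂ := u)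
    hχ₁u.symm (hb.symm.trans hχ₁ψ.symm)]
  exact (evalAt_eq_of_restriction_eq e hF _ _ s hs χ₂ (hstr χ₂ u₂ b₂ hχ₂u) z hχ₂ (u₂ := u)
    hχ₂u.symm (hb.symm.trans hχ₂ψ.symm)).symm

end SmoothVariety

/-! ### Lifting centred geometric points along smooth morphisms -/

namespace AlgebraicGeometry

/-- The lifting property of smooth morphisms for valuation rings of algebraically closed fields. -/
theorem Scheme.Hom.exists_lift_stalk {U X : Scheme.{u}} (f : U ⟶ X) [Smooth f] (x : U)
    {F : Type v} [Field F] [IsAlgClosed F] (O : ValuationSubring F)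
    (φ : X.presheaf.stalk (f x) →+* O)
    (ψ : U.presheaf.stalk x →+* IsLocalRing.ResidueField O)
    (h : ψ.comp (f.stalkMap x).hom = (IsLocalRing.residue O).comp φ) :
    ∃ θ : U.presheaf.stalk x →+* O,
      θ.comp (f.stalkMap x).hom = φ ∧ (IsLocalRing.residue O).comp θ = ψ := by
  obtain ⟨_, ⟨Y, hY, rfl⟩, hxY, -⟩ :=
    X.isBasis_affineOpens.exists_subset_of_mem_open (Set.mem_univ (f x)) isOpen_univ
  obtain ⟨_, ⟨V, hV, rfl⟩, hxV, hVY⟩ :=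
    U.isBasis_affineOpens.exists_subset_of_mem_open (show x ∈ f ⁻¹ᵁ Y from hxY) (f ⁻¹ᵁ Y).isOpen
  let := X.presheaf.algebra_section_stalk ⟨f x, hxY⟩
  have := hY.isLocalization_stalk ⟨f x, hxY⟩
  let := U.presheaf.algebra_section_stalk ⟨x, hxV⟩
  have := hV.isLocalization_stalk ⟨x, hxV⟩
  let : Algebra Γ(X, Y) Γ(U, V) := (f.appLE Y V hVY).hom.toAlgebra
  have : Algebra.Smooth Γ(X, Y) Γ(U, V) := f.smooth_appLE hY hV hVY
  have hgerm (a : Γ(X, Y)) : f.stalkMap x (X.presheaf.germ Y (f x) hxY a) =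
      U.presheaf.germ V x hxV (f.appLE Y V hVY a) := by
    have h1 : X.presheaf.germ Y (f x) hxY ≫ f.stalkMap x =
        f.appLE Y V hVY ≫ U.presheaf.germ V x hxV := by
      simp only [Scheme.Hom.germ_stalkMap, Scheme.Hom.appLE, Category.assoc,
        TopCat.Presheaf.germ_res]
    exact congrArg (fun g => g.hom a) h1
  obtain ⟨θ, hθφ, hθψ⟩ := O.exists_lift_of_smooth
    (φ.comp (X.presheaf.germ Y (f x) hxY).hom) (ψ.comp (U.presheaf.germ V x hxV).hom) (by
      ext a
      refine (congrArg ψ (hgerm a)).symm.trans ?_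
      exact congrArg (fun g => g (X.presheaf.germ Y (f x) hxY a)) h)
  -- Elements outside the prime of `x` have invertible image under `ψ`, hence are units in the local
  -- ring `O`; so `θ` extends to the stalk.
  have hunit (b : (hV.primeIdealOf ⟨x, hxV⟩).asIdeal.primeCompl) : IsUnit (θ b) := by
    have h1 := IsLocalization.map_units (U.presheaf.stalk x) b
    have h2 := h1.map ψ
    have h3 : ψ (algebraMap Γ(U, V) (U.presheaf.stalk x) b) = IsLocalRing.residue O (θ b) :=
      (congrArg (fun g => g b.1) hθψ).symm
    rw [h3] at h2
    exact isUnit_of_map_unit (IsLocalRing.residue O) _ h2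
  let Θ : U.presheaf.stalk x →+* O := IsLocalization.lift hunit
  have hΘ (b : Γ(U, V)) : Θ (U.presheaf.germ V x hxV b) = θ b := IsLocalization.lift_eq hunit b
  refine ⟨Θ, ?_, ?_⟩
  · refine IsLocalization.ringHom_ext (hY.primeIdealOf ⟨f x, hxY⟩).asIdeal.primeCompl ?_
    ext a
    refine congrArg Subtype.val ((congrArg Θ (hgerm a)).trans ((hΘ _).trans ?_))
    exact congrArg (fun g => g a) hθφ
  · refine IsLocalization.ringHom_ext (hV.primeIdealOf ⟨x, hxV⟩).asIdeal.primeCompl ?_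
    ext b
    refine (congrArg (IsLocalRing.residue O) (hΘ b)).trans ?_
    exact congrArg (fun g => g b) hθψ

end AlgebraicGeometry

namespace SmoothVariety

variable {k : Type u} [Field k]

/-- The structure of a `k`-algebra on the local ring at `y`. -/
noncomputable def stalkHom (X : SmoothVariety k) (y : X.scheme) : k →+* X.scheme.presheaf.stalk y :=
  (Spec.preimage (X.scheme.fromSpecStalk y ≫ X.str)).hom

theorem toResidue_stalkHom (X : SmoothVariety k) {x y : X.scheme} (h : x ⤳ y) (r : k) :
    X.toResidue h (X.stalkHom y r) = algebraMap k (X.scheme.residueField x) r := by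
  have h1 : CommRingCat.ofHom (X.stalkHom y) ≫ X.toResidue h =
      CommRingCat.ofHom (algebraMap k (X.scheme.residueField x)) := by
    apply Spec.map_injective
    rw [Spec.map_comp, specMap_algebraMap_residueField, stalkHom, CommRingCat.ofHom_hom,
      Spec.map_preimage, toResidue, Spec.map_comp, Category.assoc,
      ← Category.assoc (Spec.map _) (X.scheme.fromSpecStalk y),
      Scheme.SpecMap_stalkSpecializes_fromSpecStalk]
    rfl
  exact congrArg (fun g => g.hom r) h1

theorem residue_stalkHom (X : SmoothVariety k) (y : X.scheme) (r : k) :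
    X.scheme.residue y (X.stalkHom y r) = algebraMap k (X.scheme.residueField y) r := by
  rw [← toResidue_stalkHom X (specializes_refl y), toResidue_refl]

theorem specMap_toResidue_fromSpecStalk (X : SmoothVariety k) {x y : X.scheme} (h : x ⤳ y) :
    Spec.map (X.toResidue h) ≫ X.scheme.fromSpecStalk y = X.scheme.fromSpecResidueField x := by
  rw [toResidue, Spec.map_comp, Category.assoc, Scheme.SpecMap_stalkSpecializes_fromSpecStalk]
  rfl

variable {F : Type v} [Field F]

/-- The homomorphism of the local ring at the center to the valuation ring. -/
noncomputable def IsCentered.stalkMap {X : SmoothVariety k} {x y : X.scheme} {h : x ⤳ y}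
    {a : X.scheme.residueField x →+* F} {v : RatValuation F} (hc : X.IsCentered h a v) :
    X.scheme.presheaf.stalk y →+* v.valuationSubring :=
  (a.comp (X.toResidue h).hom).codRestrict v.valuationSubring fun b => (hc b).1

theorem IsCentered.isLocalHom {X : SmoothVariety k} {x y : X.scheme} {h : x ⤳ y}
    {a : X.scheme.residueField x →+* F} {v : RatValuation F} (hc : X.IsCentered h a v) :
    IsLocalHom ((IsLocalRing.residue v.valuationSubring).comp hc.stalkMap) := by
  refine ⟨fun b hb => ?_⟩
  by_contra hb'
  obtain ⟨c, hc'⟩ := (isUnit_of_map_unit (IsLocalRing.residue v.valuationSubring) _ hb).exists_right_inv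
  have h1 : v (a (X.toResidue h b)) * v c = 1 := by
    rw [← map_mul, ← map_one v]
    exact congrArg (fun z => v z.1) hc'
  exact absurd h1 (mul_lt_one_of_lt_of_le ((hc b).2 hb') c.2).ne

variable [Algebra k F]

theorem IsCentered.exists_residueField_algHom {X : SmoothVariety k} {x y : X.scheme} {h : x ⤳ y}
    {a : X.scheme.residueField x →ₐ[k] F} {v : RatValuation F}
    (hc : X.IsCentered h (a : _ →+* F) v) (hv : IsDiscreteRankOne k v) :
    let := hv.residueAlgebra
    ∃ α : X.scheme.residueField y →ₐ[k] IsLocalRing.ResidueField v.valuationSubring,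
      ∀ b, α (X.scheme.residue y b) = IsLocalRing.residue _ (hc.stalkMap b) := by
  intro
  have := hc.isLocalHom
  let α : X.scheme.residueField y →+* IsLocalRing.ResidueField v.valuationSubring :=
    IsLocalRing.ResidueField.lift ((IsLocalRing.residue v.valuationSubring).comp hc.stalkMap)
  have hα (b) : α (X.scheme.residue y b) = IsLocalRing.residue _ (hc.stalkMap b) :=
    IsLocalRing.ResidueField.lift_residue_apply _ b
  refine ⟨{ α with commutes' := fun r => ?_ }, hα⟩
  change α (algebraMap k _ r) = _
  rw [← residue_stalkHom, hα]
  refine congrArg (IsLocalRing.residue v.valuationSubring) (Subtype.ext ?_)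
  exact (congrArg a (X.toResidue_stalkHom h r)).trans (a.commutes r)

variable {Ω : Type u} [Field Ω] [Algebra k Ω]

theorem geomPoint_eq_specMap_fromSpecStalk (e : F ≃ₐ[k] Ω) (X : SmoothVariety k) {x y : X.scheme}
    (h : x ⤳ y) (a : X.scheme.residueField x →ₐ[k] F) :
    X.geomPoint e x a = Spec.map (CommRingCat.ofHom
      (((e : F →ₐ[k] Ω).comp a).toRingHom.comp (X.toResidue h).hom)) ≫ X.scheme.fromSpecStalk y := by
  rw [geomPoint, ← specMap_toResidue_fromSpecStalk X h, ← Category.assoc, ← Spec.map_comp]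
  rfl

variable [IsAlgClosed F]

/-- Along a smooth morphism, a generic geometric point of the target whose valuation is centered in
codimension at most one at a point of the image lifts to such a point of the source. -/
theorem exists_isCentered_lift (e : F ≃ₐ[k] Ω) (hF : Algebra.trdeg k F = Cardinal.aleph0)
    {U X : SmoothVariety k} (f : U ⟶ X) (hf : Smooth f.hom) {x y : X.scheme}
    (hx : coheight x = 0) (h : x ⤳ y) (hy : coheight y ≤ 1) (hsurj : ∃ u, f.hom u = y)
    (a : X.scheme.residueField x →ₐ[k] F) {v : RatValuation F} (hv : IsDiscreteRankOne k v)
    (hc : X.IsCentered h (a : _ →+* F) v) :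
    ∃ (u u' : U.scheme) (b : U.scheme.residueField u →ₐ[k] F) (h' : u ⤳ u'), coheight u = 0 ∧
      coheight u' ≤ 1 ∧ U.IsCentered h' (b : _ →+* F) v ∧
      U.geomPoint e u b ≫ f.hom = X.geomPoint e x a := by
  obtain ⟨u₀, hu₀⟩ := hsurj
  -- Take `u'` generic in the fibre over `y`, so that its codimension does not exceed that of `y`.
  obtain ⟨u', -, rfl, hu'⟩ := Scheme.exists_specializes_maximal (fun u => f.hom u = y) hu₀
  have hle : coheight u' ≤ coheight (f.hom u') := f.hom.coheight_le_of_generic_in_fibre u' hu'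
  let := hv.residueAlgebra
  obtain ⟨α, hα⟩ := hc.exists_residueField_algHom hv
  obtain ⟨β, hβ⟩ := exists_algHom_extending (hv.aleph0_le_trdeg hF)
    (residueFieldAlgHom f.hom f.w u') α
  obtain ⟨θ, hθφ, hθψ⟩ := f.hom.exists_lift_stalk u' v.valuationSubring hc.stalkMap
    ((β : _ →+* _).comp (U.scheme.residue u').hom) (by
      ext b
      have h1 : U.scheme.residue u' (f.hom.stalkMap u' b) =
          f.hom.residueFieldMap u' (X.scheme.residue _ b) :=
        congrArg (fun g => g.hom b) (Scheme.residue_residueFieldMap f.hom u').symm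
      refine (congrArg β h1).trans ?_
      exact (congrArg (fun g => g (X.scheme.residue _ b)) hβ).trans (hα b))
  let θΩ : U.scheme.presheaf.stalk u' →+* Ω :=
    (e : F →+* Ω).comp (v.valuationSubring.subtype.comp θ)
  let η : Spec (CommRingCat.of Ω) ⟶ U.scheme :=
    Spec.map (CommRingCat.ofHom θΩ) ≫ U.scheme.fromSpecStalk u'
  have hη : η ≫ f.hom = X.geomPoint e x a := by
    rw [Category.assoc, ← Scheme.SpecMap_stalkMap_fromSpecStalk, ← Category.assoc,
      ← Spec.map_comp,
      X.geomPoint_eq_specMap_fromSpecStalk e h]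
    congr 2
    ext b
    exact congrArg (fun g => e (g b).1) hθφ
  let z : Spec (CommRingCat.of Ω) := Classical.choice inferInstance
  obtain ⟨b, hb⟩ := U.eq_geomPoint e η (by rw [← f.w, ← Category.assoc, hη, geomPoint_str]) z
  have h' : η z ⤳ u' := by
    have h1 : η z ∈ Set.range (U.scheme.fromSpecStalk u') := ⟨Spec.map (CommRingCat.ofHom θΩ) z, rfl⟩
    rwa [Scheme.range_fromSpecStalk] at h1
  have hfη : f.hom (η z) = x := by
    rw [← Scheme.Hom.comp_apply, hη, geomPoint_apply]
  -- Either `η z` is `u'`, whose image is then the generic point `x`, or it is a proper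
  -- generalization of a point of codimension at most one.
  have h0 : coheight (η z) = 0 := by
    by_cases heq : η z = u'
    · have h1 : x = f.hom u' := by rw [← heq, hfη]
      rw [heq]
      exact le_antisymm (hle.trans (by rw [← h1, hx])) zero_le
    · have h1 := coheight_add_one_le (Scheme.lt_of_specializes_of_ne h' heq)
      have h2 : coheight (η z) + 1 ≤ 0 + 1 := h1.trans ((hle.trans hy).trans_eq (zero_add 1).symm)
      exact le_antisymm ((ENat.add_le_add_iff_right ENat.one_ne_top).1 h2) zero_le
  refine ⟨η z, u', b, h', h0, hle.trans hy, ?_, by rw [← hb, hη]⟩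
  have hkey := Spec.map_injective ((cancel_mono (U.scheme.fromSpecStalk u')).1
    ((U.geomPoint_eq_specMap_fromSpecStalk e h' b).symm.trans hb.symm))
  have hkey' (c : U.scheme.presheaf.stalk u') : b (U.toResidue h' c) = (θ c : F) :=
    e.injective (congrArg (fun g => g.hom c) hkey)
  intro c
  change v (b (U.toResidue h' c)) ≤ 1 ∧ (_ → v (b (U.toResidue h' c)) < 1)
  rw [hkey']
  refine ⟨(θ c).2, fun hcm => ?_⟩
  have h1 : IsLocalRing.residue v.valuationSubring (θ c) = 0 := by
    have h2 : IsLocalRing.residue v.valuationSubring (θ c) = β (U.scheme.residue u' c) :=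
      congrArg (fun g => g c) hθψ
    have h3 : U.scheme.residue u' c = 0 := (IsLocalRing.residue_eq_zero_iff c).2 hcm
    rw [h2, h3, map_zero]
  exact (Valuation.mem_maximalIdeal_iff F v).1 ((IsLocalRing.residue_eq_zero_iff _).1 h1)

end SmoothVariety

/-! ### Exactness for a covering -/

namespace SmoothVariety

variable {k : Type u} [Field k] {F : Type v} [Field F] [Algebra k F]
  {W : Type w} [AddCommGroup W] [Module ℚ W]
  {Ω : Type u} [Field Ω] [Algebra k Ω]

theorem geomPoint_comp_algEquiv (e : F ≃ₐ[k] Ω) (X : SmoothVariety k) (x : X.scheme)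
    (a : X.scheme.residueField x →ₐ[k] F) (σ : F ≃ₐ[k] F) :
    X.geomPoint e x ((σ : F →ₐ[k] F).comp a) =
      Spec.map (CommRingCat.ofHom (e.symm.trans (σ.trans e) : Ω →+* Ω)) ≫ X.geomPoint e x a := by
  rw [geomPoint, geomPoint, ← Category.assoc, ← Spec.map_comp]
  congr 2
  ext z
  exact congrArg (fun c => e (σ c)) (e.symm_apply_apply (a z)).symm

theorem geomPoint_comp_eq_of_algEquiv (e : F ≃ₐ[k] Ω) {U X : SmoothVariety k}
    {f : U.scheme ⟶ X.scheme} {u : U.scheme} {x : X.scheme} {b : U.scheme.residueField u →ₐ[k] F}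
    {a : X.scheme.residueField x →ₐ[k] F} (h : U.geomPoint e u b ≫ f = X.geomPoint e x a)
    (σ : F ≃ₐ[k] F) : U.geomPoint e u ((σ : F →ₐ[k] F).comp b) ≫ f =
      X.geomPoint e x ((σ : F →ₐ[k] F).comp a) := by
  rw [geomPoint_comp_algEquiv, geomPoint_comp_algEquiv, Category.assoc, h]

variable [IsAlgClosed F] (hF : Algebra.trdeg k F = Cardinal.aleph0)

/-- A generization of a preimage of the generic point `x` still lies over `x`, so a generic preimage
exists; its residue field embeds over `a`. -/
theorem exists_geomPoint_lift (hF : Algebra.trdeg k F = Cardinal.aleph0) (e : F ≃ₐ[k] Ω)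
    {U X : SmoothVariety k} (f : U ⟶ X) (x : GenericPoint X) (hx : ∃ u, f.hom u = x.1)
    (a : X.scheme.residueField x.1 →ₐ[k] F) :
    ∃ (u : GenericPoint U) (b : U.scheme.residueField u.1 →ₐ[k] F),
      U.geomPoint e u b ≫ f.hom = X.geomPoint e x a := by
  obtain ⟨u₀, hu₀⟩ := hx
  obtain ⟨x, hx⟩ := x
  obtain ⟨u, hu, hu0⟩ := Scheme.exists_specializes_coheight_eq_zero u₀
  obtain rfl : f.hom u = x := Scheme.eq_of_specializes hx (by
    have h1 := hu.map f.hom.continuous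
    rwa [hu₀] at h1)
  obtain ⟨b, hb⟩ := exists_algHom_extending hF.ge (residueFieldAlgHom f.hom f.w u) a
  exact ⟨⟨u, hu0⟩, b, by rw [geomPoint_comp e f.hom f.w, hb]⟩

variable {ρ : Representation ℚ (F ≃ₐ[k] F) W} {ι : EmbeddingChoice k F}

theorem evalAt_restriction_of_eq (e : F ≃ₐ[k] Ω) {U X : SmoothVariety k} (f : U ⟶ X)
    (t : Sections ρ ι X) {u : GenericPoint U} {b : U.scheme.residueField u.1 →ₐ[k] F}
    {x : GenericPoint X} {a : X.scheme.residueField x.1 →ₐ[k] F}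
    (h : U.geomPoint e u b ≫ f.hom = X.geomPoint e x a) :
    evalAt hF (restriction hF ρ ι f t) u b = evalAt hF t x a := by
  rw [evalAt_restriction]
  refine evalAt_congr e hF t ?_
  rw [← h]
  exact (geomPoint_comp e f.hom f.w u.1 b).symm

theorem restriction_injective (e : F ≃ₐ[k] Ω) {U X : SmoothVariety k} (f : U ⟶ X)
    (hf : IsCovering f) : Function.Injective (restriction hF ρ ι f) := by
  intro t t' h
  refine funext fun x => Subtype.ext ?_
  obtain ⟨u, b, hb⟩ := exists_geomPoint_lift hF e f x (hf.surj x.1 (x.2.trans_le zero_le)) (ι X x)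
  rw [← evalAt_self hF t x, ← evalAt_self hF t' x, ← evalAt_restriction_of_eq hF e f t hb,
    ← evalAt_restriction_of_eq hF e f t' hb, h]

/-- The values of a section at embeddings with a divisorial valuation belong to the local part. -/
theorem evalAt_mem_localPart {U : SmoothVariety k} (s : Sections ρ ι U) (u : GenericPoint U)
    (b : U.scheme.residueField u.1 →ₐ[k] F) {v : RatValuation F} (hv : IsDiscreteRankOne k v)
    {u' : U.scheme} (h : u.1 ⤳ u') (hu' : coheight u' ≤ 1) (hc : U.IsCentered h (b : _ →+* F) v) :
    evalAt hF s u b ∈ localPart ρ v := by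
  obtain ⟨τ, hτ⟩ := exists_embedding_extends hF ι U u b
  rw [evalAt_eq hF s u b τ hτ, ← mem_localPart_comp_iff]
  refine (Submodule.mem_iInf _).1 ((Submodule.mem_iInf _).1 (s u).2.2 _) ?_
  refine (U.mem_divisorialValuations_iff u.2 _ _).2 ⟨hv.comp τ, u', h, hu', fun c => ?_⟩
  exact ⟨(congrArg v (hτ _)).trans_le (hc c).1, fun hm => (congrArg v (hτ _)).trans_lt ((hc c).2 hm)⟩

variable [IsAlgClosed Ω]

theorem exists_restriction_eq (e : F ≃ₐ[k] Ω) {U X : SmoothVariety k} (f : U ⟶ X)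
    (hf : IsCovering f) (s : Sections ρ ι U)
    (hs : restriction hF ρ ι (fibreSquareFst f hf.smooth) s =
      restriction hF ρ ι (fibreSquareSnd f hf.smooth) s) :
    ∃ t, restriction hF ρ ι f t = s := by
  -- The value of the glued section at `x` will be the value of `s` at any lift of the chosen
  -- geometric point.
  choose u b hub using fun x : GenericPoint X =>
    exists_geomPoint_lift hF e f x (hf.surj x.1 (x.2.trans_le zero_le)) (ι X x)
  have key (x : GenericPoint X) (u' : GenericPoint U) (b' : U.scheme.residueField u'.1 →ₐ[k] F)
      (σ : F ≃ₐ[k] F) (h : U.geomPoint e u' b' ≫ f.hom =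
        X.geomPoint e x ((σ : F →ₐ[k] F).comp (ι X x))) :
      ρ σ (evalAt hF s (u x) (b x)) = evalAt hF s u' b' := by
    rw [evalAt_smul]
    refine evalAt_eq_of_comp_eq hF e f hf.smooth s hs ?_
    rw [geomPoint_comp_eq_of_algEquiv e (hub x) σ, h]
  have key1 (x : GenericPoint X) (u' : GenericPoint U) (b' : U.scheme.residueField u'.1 →ₐ[k] F)
      (h : U.geomPoint e u' b' ≫ f.hom = X.geomPoint e x (ι X x)) :
      evalAt hF s (u x) (b x) = evalAt hF s u' b' := by
    have h1 := key x u' b' 1 h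
    rwa [map_one] at h1
  have hmem (x : GenericPoint X) : evalAt hF s (u x) (b x) ∈ componentSections ρ ι X x := by
    refine ⟨mem_fixedVectors_iff.2 fun σ hσ => ?_,
      (Submodule.mem_iInf _).2 fun v => (Submodule.mem_iInf _).2 fun hv => ?_⟩
    -- An automorphism over `k(x)` moves the lift to another lift of the same geometric point.
    · refine key x (u x) (b x) σ ((hub x).trans ?_)
      congr 1
      ext z
      exact (hσ _ ⟨z, rfl⟩).symm
    · obtain ⟨hv1, y, h, hy, hc⟩ := (X.mem_divisorialValuations_iff x.2 _ _).1 hv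
      obtain ⟨u₁, u', b', h', h0, h1, hc', hb'⟩ := exists_isCentered_lift e hF f hf.smooth x.2 h hy
        (hf.surj y hy) (ι X x) hv1 hc
      rw [key1 x ⟨u₁, h0⟩ b' hb']
      exact evalAt_mem_localPart hF s ⟨u₁, h0⟩ b' hv1 h' h1 hc'
  refine ⟨fun x => ⟨_, hmem x⟩, funext fun u' => Subtype.ext ?_⟩
  obtain ⟨τ, hτ⟩ := exists_extends hF ι f u'
  rw [restriction_apply hF ρ ι f _ u' τ hτ, ← evalAt_self hF s u']
  refine key _ u' (ι U u') τ ((geomPoint_comp e f.hom f.w u'.1 (ι U u')).trans ?_)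
  change X.geomPoint e (f.hom u'.1) _ = X.geomPoint e (f.hom u'.1) _
  congr 1
  ext z
  exact (hτ z).symm

end SmoothVariety

/-! ### Base change of coverings and the sheaf property -/

namespace AlgebraicGeometry

/-- Generalizations in a fibre lift along a base change. -/
theorem Scheme.exists_specializes_of_isPullback {P U Y X : Scheme.{u}} {p : P ⟶ U} {q : P ⟶ Y}
    {f : U ⟶ X} {g : Y ⟶ X} (h : IsPullback p q f g) (v : P) {u : U} (hu : u ⤳ p v)
    (hfu : f u = f (p v)) : ∃ v', v' ⤳ v ∧ p v' = u ∧ q v' = q v := by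
  have hw : f (p v) = g (q v) := by
    rw [← Scheme.Hom.comp_apply, h.w, Scheme.Hom.comp_apply]
  -- The fibre of `q` is the fibre of `f` base changed along an extension of residue fields; that
  -- base change is flat, so generalizations lift.
  have hsq := isPullback_fiberToSpecResidueField_of_isPullback h (q v)
  obtain ⟨l, hl, hfl⟩ : ∃ l : q.fiber (q v) ⟶ f.fiber (g (q v)), Flat l ∧
      l ≫ f.fiberι _ = q.fiberι _ ≫ p :=
    ⟨_, MorphismProperty.of_isPullback (P := @Flat) hsq.flip inferInstance, pullback.lift_fst _ _ _⟩
  have hl' (w : q.fiber (q v)) : f.fiberι _ (l w) = p (q.fiberι _ w) := by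
    rw [← Scheme.Hom.comp_apply, hfl, Scheme.Hom.comp_apply]
  obtain ⟨u', rfl⟩ : u ∈ Set.range (f.fiberι (g (q v))) := by
    rw [Scheme.Hom.range_fiberι]
    exact hfu.trans hw
  have h1 : u' ⤳ l (q.asFiber v) := by
    rw [← (f.fiberι (g (q v))).isEmbedding.isInducing.specializes_iff, hl',
      Scheme.Hom.fiberι_asFiber]
    exact hu
  obtain ⟨w, hw, rfl⟩ := Flat.generalizingMap l h1
  refine ⟨q.fiberι _ w, ?_, (hl' w).symm, ?_⟩
  · have h2 := hw.map (q.fiberι (q v)).continuous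
    rwa [Scheme.Hom.fiberι_asFiber] at h2
  · have h2 : q.fiberι (q v) w ∈ Set.range (q.fiberι (q v)) := ⟨w, rfl⟩
    rwa [Scheme.Hom.range_fiberι] at h2

theorem Scheme.coheight_le_of_isPullback_of_generic {P U Y X : Scheme.{u}} [IsLocallyNoetherian U]
    [IsLocallyNoetherian X] {p : P ⟶ U} {q : P ⟶ Y} {f : U ⟶ X} {g : Y ⟶ X} (h : IsPullback p q f g)
    {v : P} (hv : ∀ v', v' ⤳ v → q v' = q v → v' = v) : coheight (p v) ≤ coheight (g (q v)) := by
  have hw : f (p v) = g (q v) := by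
    rw [← Scheme.Hom.comp_apply, h.w, Scheme.Hom.comp_apply]
  rw [← hw]
  refine f.coheight_le_of_generic_in_fibre (p v) fun u hu hfu => ?_
  obtain ⟨v', h1, rfl, h2⟩ := exists_specializes_of_isPullback h v hu hfu
  rw [hv v' h1 h2]

end AlgebraicGeometry

namespace SmoothVariety

variable {k : Type u} [Field k]

/-- The base change of a covering of the Hartogs site along a morphism of the Hartogs site. -/
theorem IsCovering.exists_base_change {U X Y : SmoothVariety k} {f : U ⟶ X} (hf : IsCovering f)
    (g : Y ⟶ X) : ∃ (V : SmoothVariety k) (q : V ⟶ Y) (p : V ⟶ U), IsCovering q ∧ p ≫ f = q ≫ g := by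
  have hs := hf.smooth
  have hsep : IsSeparated f.hom := by
    have : IsSeparated (f.hom ≫ X.str) := f.w ▸ U.separated
    exact IsSeparated.of_comp f.hom X.str
  have hqc : QuasiCompact f.hom := by
    have : QuasiCompact (f.hom ≫ X.str) := f.w ▸ U.quasiCompact
    exact QuasiCompact.of_comp f.hom X.str
  have hsq := IsPullback.of_hasPullback f.hom g.hom
  have hsmooth : Smooth (pullback.snd f.hom g.hom) := inferInstance
  let V : SmoothVariety k :=
    { scheme := pullback f.hom g.hom
      str := pullback.snd f.hom g.hom ≫ Y.str }
  let q : V ⟶ Y := ofSmooth (U := V) (pullback.snd f.hom g.hom) rfl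
  have hgle (y : Y.scheme) (hy : coheight y ≤ 1) : coheight (g.hom y) ≤ 1 := by
    rcases Order.le_one_iff.1 hy with h | h
    · exact (g.dominant y h).trans_le zero_le
    · exact Order.le_one_iff.2 (g.divisor y h)
  have hgen (v : V.scheme) (hv : coheight v = 0) :
      coheight (pullback.fst f.hom g.hom v) = 0 := by
    refine le_antisymm ((Scheme.coheight_le_of_isPullback_of_generic hsq
      fun v' hv' _ => Scheme.eq_of_specializes hv hv').trans ?_) zero_le
    exact (g.dominant _ (q.dominant v hv)).le
  let p : V ⟶ U :=
    { hom := pullback.fst f.hom g.hom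
      w := by
        rw [← f.w, ← Category.assoc, pullback.condition, Category.assoc, g.w]
      dominant := hgen
      divisor := fun v hv => by
        rw [← Order.le_one_iff]
        by_cases hfib : ∀ v', v' ⤳ v → pullback.snd f.hom g.hom v' = pullback.snd f.hom g.hom v →
            v' = v
        · refine (Scheme.coheight_le_of_isPullback_of_generic hsq hfib).trans (hgle _ ?_)
          exact Order.le_one_iff.2 (q.divisor v hv)
        -- Here `v` is not generic in its fibre over `Y`, so this fibre contains a generic point of
        -- `V` and lies over a generic point of `X`. Proper generalizations of the image of `v` in
        -- `U` stay in the fibre over that point, so they lift to proper generalizations of `v`,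
        -- which are generic.
        · push Not at hfib
          obtain ⟨v', hv', hqv, hne⟩ := hfib
          have hlt (w : V.scheme) (hw : w ⤳ v) (hwv : w ≠ v) : coheight w = 0 := by
            have h1 := coheight_add_one_le (Scheme.lt_of_specializes_of_ne hw hwv)
            rw [hv] at h1
            exact le_antisymm ((ENat.add_le_add_iff_right ENat.one_ne_top).1
              (h1.trans_eq (zero_add 1).symm)) zero_le
          have hx : coheight (f.hom (pullback.fst f.hom g.hom v)) = 0 := by
            rw [← Scheme.Hom.comp_apply, pullback.condition, Scheme.Hom.comp_apply, ← hqv]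
            exact g.dominant _ (q.dominant v' (hlt v' hv' hne))
          refine Order.coheight_le_coe_iff.2 fun u hu => ?_
          have hu' : u ⤳ pullback.fst f.hom g.hom v := hu.le
          obtain ⟨w, hw, rfl, -⟩ := Scheme.exists_specializes_of_isPullback hsq v hu'
            (Scheme.eq_of_specializes hx (hu'.map f.hom.continuous))
          have hwv : w ≠ v := by
            rintro rfl
            exact lt_irrefl _ hu
          rw [hgen w (hlt w hw hwv)]
          exact one_pos }
  refine ⟨V, q, p, ⟨hsmooth, fun y hy => ?_⟩, Hom.ext pullback.condition⟩
  obtain ⟨u, hu⟩ := hf.surj _ (hgle y hy)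
  obtain ⟨v, -, hv⟩ := Scheme.Pullback.exists_preimage_pullback u y hu
  exact ⟨v, hv⟩

variable (k) in
/-- The coverage of the Hartogs site. -/
def hartogsCoverage : Coverage (SmoothVariety k) where
  toPrecoverage := hartogsPrecoverage k
  pullback := by
    rintro X Y g _ ⟨U, f, hf, rfl⟩
    obtain ⟨V, q, p, hq, h⟩ := hf.exists_base_change g
    refine ⟨_, ⟨V, q, hq, rfl⟩, ?_⟩
    rintro _ _ ⟨⟩
    exact ⟨U, p, f, ⟨⟩, h⟩

/-- A presheaf of modules for which the sequences of the coverings are exact is a sheaf. -/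
theorem isSheaf_of_exact {R : Type v} [Ring R] (P : (SmoothVariety k)ᵒᵖ ⥤ ModuleCat.{w} R)
    (hinj : ∀ (U X : SmoothVariety k) (f : U ⟶ X), IsCovering f → Function.Injective (P.map f.op))
    (hglue : ∀ (U X : SmoothVariety k) (f : U ⟶ X) (hf : IsCovering f) (s : P.obj (op U)),
      P.map (fibreSquareFst f hf.smooth).op s = P.map (fibreSquareSnd f hf.smooth).op s →
        ∃ t, P.map f.op t = s) :
    Presheaf.IsSheaf (hartogsTopology k) P := by
  intro E
  rw [show hartogsTopology k = (hartogsCoverage k).toGrothendieck from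
    Coverage.toGrothendieck_toPrecoverage (hartogsCoverage k)]
  refine (Presieve.isSheaf_coverage (hartogsCoverage k) _).2 ?_
  rintro X _ ⟨U, f, hf, rfl⟩ s hs
  rw [Presieve.FamilyOfElements.compatible_singleton_iff] at hs
  let φ : E ⟶ P.obj (op U) := s f ⟨⟩
  -- Compatibility is needed only for the two projections, whose composites with `f` agree; no
  -- universal property of `U ×_X U` within the site is involved.
  have hs' : φ ≫ P.map (fibreSquareFst f hf.smooth).op =
      φ ≫ P.map (fibreSquareSnd f hf.smooth).op :=
    hs _ _ (Hom.ext pullback.condition)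
  have hmem (x : E) : φ x ∈ LinearMap.range (P.map f.op).hom :=
    hglue U X f hf _ (congrArg (fun m => m.hom x) hs')
  -- Pointwise gluings are unique, so inverting `P.map f.op` on its range assembles them into a
  -- linear map.
  let t : E ⟶ P.obj (op X) := ModuleCat.ofHom
    ((LinearEquiv.ofInjective (P.map f.op).hom (hinj U X f hf)).symm.toLinearMap.comp
      (φ.hom.codRestrict _ hmem))
  have ht : t ≫ P.map f.op = φ := by
    ext x
    exact congrArg Subtype.val ((LinearEquiv.ofInjective (P.map f.op).hom
      (hinj U X f hf)).apply_symm_apply ⟨_, hmem x⟩)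
  refine ⟨t, (Presieve.FamilyOfElements.isAmalgamation_singleton_iff _ _ _).2 ht, fun t' h' => ?_⟩
  have h1 : t' ≫ P.map f.op = φ :=
    (Presieve.FamilyOfElements.isAmalgamation_singleton_iff _ _ _).1 h'
  refine ModuleCat.hom_ext (LinearMap.ext fun x => hinj U X f hf ?_)
  exact congrArg (fun m => m.hom x) (h1.trans ht.symm)

end SmoothVariety

theorem IsAlgClosed.of_algEquiv {k F Ω : Type*} [Field k] [Field F] [Field Ω] [Algebra k F]
    [Algebra k Ω] [IsAlgClosed F] (e : F ≃ₐ[k] Ω) : IsAlgClosed Ω := by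
  refine IsAlgClosed.of_exists_root _ fun p _ hp => ?_
  obtain ⟨r, hr⟩ := IsAlgClosed.exists_root (p.map (e.symm : Ω →+* F)) (by
    rw [Polynomial.degree_map]
    exact (Polynomial.degree_pos_of_irreducible hp).ne')
  refine ⟨e r, e.symm.injective ?_⟩
  have h := p.eval₂_at_apply (e.symm : Ω →+* F) (e r)
  rw [Polynomial.IsRoot.def, Polynomial.eval_map] at hr
  rw [map_zero, ← hr]
  exact h.symm.trans (congrArg (fun c => p.eval₂ (e.symm : Ω →+* F) c) (e.symm_apply_apply r))

theorem mainTheorem11 {k : Type u} [Field k] [CharZero k] {F : Type v} [Field F] [Algebra k F]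
    [IsAlgClosed F] (hF : Algebra.trdeg k F = Cardinal.aleph0)
    {W : Type w} [AddCommGroup W] [Module ℚ W]
    (ρ : Representation ℚ (F ≃ₐ[k] F) W) (hρ : IsSmoothRep ρ)
    (ι : SmoothVariety.EmbeddingChoice k F) :
    (∀ (U X : SmoothVariety k) (f : U ⟶ X) (x : SmoothVariety.GenericPoint U),
      ∃ τ : F ≃ₐ[k] F, SmoothVariety.Extends ι f x τ) ∧
    ∃ (P : (SmoothVariety k)ᵒᵖ ⥤ ModuleCat.{max u w} ℚ)
      (e : ∀ X : SmoothVariety k, P.obj (op X) ≃ₗ[ℚ] SmoothVariety.Sections ρ ι X),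
      (∀ (U X : SmoothVariety k) (f : U ⟶ X) (s : P.obj (op X))
        (x : SmoothVariety.GenericPoint U) (τ : F ≃ₐ[k] F), SmoothVariety.Extends ι f x τ →
          (e U (P.map f.op s) x : W) = ρ τ (e X s (SmoothVariety.Hom.onGeneric f x) : W)) ∧
      Presheaf.IsSheaf (SmoothVariety.hartogsTopology k) P ∧
      ∀ (U X : SmoothVariety k) (f : U ⟶ X) (hf : SmoothVariety.IsCovering f),
        Function.Injective (P.map f.op) ∧
        ∀ s : P.obj (op U),
          P.map (SmoothVariety.fibreSquareFst f hf.smooth).op s =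
            P.map (SmoothVariety.fibreSquareSnd f hf.smooth).op s →
          ∃ t : P.obj (op X), P.map f.op t = s := by
  have := small_of_trdeg_eq_aleph0 k F hF
  let e : F ≃ₐ[k] Shrink.{u} F := (Shrink.algEquiv k F).symm
  have : IsAlgClosed (Shrink.{u} F) := IsAlgClosed.of_algEquiv e
  have hinj (U X : SmoothVariety k) (f : U ⟶ X) (hf : SmoothVariety.IsCovering f) :
      Function.Injective ((SmoothVariety.sectionsPresheaf hF ρ ι).map f.op) :=
    SmoothVariety.restriction_injective hF e f hf
  have hglue (U X : SmoothVariety k) (f : U ⟶ X) (hf : SmoothVariety.IsCovering f)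
      (s : (SmoothVariety.sectionsPresheaf hF ρ ι).obj (op U))
      (hs : (SmoothVariety.sectionsPresheaf hF ρ ι).map (SmoothVariety.fibreSquareFst f hf.smooth).op s =
        (SmoothVariety.sectionsPresheaf hF ρ ι).map (SmoothVariety.fibreSquareSnd f hf.smooth).op s) :
      ∃ t, (SmoothVariety.sectionsPresheaf hF ρ ι).map f.op t = s :=
    SmoothVariety.exists_restriction_eq hF e f hf s hs
  exact ⟨fun U X f x => SmoothVariety.exists_extends hF ι f x, SmoothVariety.sectionsPresheaf hF ρ ι,
    fun X => LinearEquiv.refl ℚ _, fun U X f s x τ hτ => SmoothVariety.restriction_apply hF ρ ι f s x τ hτ,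
    SmoothVariety.isSheaf_of_exact _ hinj hglue, fun U X f hf => ⟨hinj U X f hf, hglue U X f hf⟩⟩
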